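/- Let $\mu,\nu$ be finite Borel measures on $\mathbb{R}$ with finite first moments, in convex order $\mu\le_c\nu$ (that is, $\mu(\phi)\le\nu(\phi)$ for all convex $\phi:\mathbb{R}\to\mathbb{R}$). Put $u_\mu(x)=\int|x-y|\,\mu(dy)$, $u_\nu(x)=\int|x-y|\,\nu(dy)$ and $I=\{u_\mu<u_\nu\}$. Assume that $(\mu,\nu)$ is irreducible: $I$ is connected and $\mu(I)=\mu(\mathbb{R})$. Let $J$ be the union of $I$ and the endpoints of $I$ that are atoms of $\nu$. For a concave $\chi:J\to\mathbb{R}$, let $-\chi''$ be the second derivative measure of the convex function $-\chi$ on $I$, let $\Delta\chi$ denote the jumps of $\chi$ at the endpoints of $I$ in $J$, and set $$(\mu-\nu)(\chi)=\tfrac12\int_I(u_\mu-u_\nu)\,d\chi''+\int_{J\setminus I}|\Delta\chi|\,d\nu\in[0,\infty].$$ A concave moderator of a pair of Borel functions $\varphi,\psi:J\to[-\infty,\infty]$ is a concave function $\chi:J\to\mathbb{R}$ with $\varphi-\chi\in L^1(\mu)$ and $\psi+\chi\in L^1(\nu)$; if there is one, then $$\mu(\varphi)+\nu(\psi):=\mu(\varphi-\chi)+\nu(\psi+\chi)+(\mu-\nu)(\chi)\in(-\infty,\infty],$$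 which does not depend on the choice of $\chi$. Let $L^c(\mu,\nu)$ be the set of pairs of Borel functions $\varphi,\psi:J\to[-\infty,\infty]$ that have a concave moderator $\chi$ with $(\mu-\nu)(\chi)<\infty$. For $f:J\to[0,\infty]$, let $\widetilde{\mathcal D}_{\mu,\nu}(f)$ be the set of pairs $(\varphi,\psi)\in L^c(\mu,\nu)$ with $\varphi$ concave, $\psi$ convex and $\varphi+\psi\ge f$ on $J$. **Proposition.** Let $f,f_n:J\to[0,\infty]$ $(n\in\mathbb{N})$ be such that $f_n\to f$ pointwise on $J$, and let $(\varphi_n,\psi_n)\in\widetilde{\mathcal D}_{\mu,\nu}(f_n)$ with $\sup_n\{\mu(\varphi_n)+\nu(\psi_n)\}<\infty$. Then there is $(\varphi,\psi)\in\widetilde{\mathcal D}_{\mu,\nu}(f)$ such that $$\mu(\varphi)+\nu(\psi)\le\liminf_{n\to\infty}\{\mu(\varphi_n)+\nu(\psi_n)\}.$$ -/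

import Mathlib

open MeasureTheory Set Filter Topology
open scoped ENNReal

namespace AuxDual

/-! ### Convex order, potential functions, irreducible pairs

All measures below are finite Borel measures on `ℝ` with a finite first moment; these two
properties are hypotheses of the theorem. -/

/-- The convex order: `μ(φ) ≤ ν(φ)` for every convex `φ : ℝ → ℝ`. Convex functions are bounded from
below by affine ones, so both integrals are well defined in `(-∞, ∞]`. For `ν(φ) = ∞` the
inequality is void; for `ν(φ) < ∞` it says that `μ(φ)` is finite, too, and at most `ν(φ)`. -/
def ConvexOrder (μ ν : Measure ℝ) : Prop :=
  ∀ φ : ℝ → ℝ, ConvexOn ℝ univ φ → Integrable φ ν →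
    Integrable φ μ ∧ ∫ x, φ x ∂μ ≤ ∫ x, φ x ∂ν

/-- The potential function `u_μ(x) = ∫ |x - y| μ(dy)`. -/
noncomputable def potential (μ : Measure ℝ) (x : ℝ) : ℝ := ∫ y, |x - y| ∂μ

/-- The set `I = {u_μ < u_ν}`. -/
def domI (μ ν : Measure ℝ) : Set ℝ := {x | potential μ x < potential ν x}

/-- The set `J`: the union of `I` and those endpoints of `I` that are atoms of `ν`.
(For the open interval `I`, the endpoints are the points of the frontier.) -/
def domJ (μ ν : Measure ℝ) : Set ℝ := domI μ ν ∪ {b | b ∈ frontier (domI μ ν) ∧ 0 < ν {b}}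

/-- The pair `μ ≤_c ν` is irreducible (with domain `(I, J)`). -/
structure Irreducible (μ ν : Measure ℝ) : Prop where
  convexOrder : ConvexOrder μ ν
  connected : IsPreconnected (domI μ ν)
  concentrated : μ (domI μ ν) = μ univ

/-! ### The second derivative measure of a concave function -/

/-- The right derivative of `-χ`. -/
noncomputable def negRightDeriv (χ : ℝ → ℝ) (x : ℝ) : ℝ :=
  derivWithin (fun y => -χ y) (Ioi x) x

/-- The second derivative measure `-χ''` on the open interval `I` of the convex function `-χ`, i.e.
the Stieltjes measure on `I` of the right derivative `g` of `-χ`. It is constructed as the image of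
Lebesgue measure under the generalized inverse `s ↦ inf {x ∈ I | s ≤ g x}` of `g`; see
`negSecondDeriv_Ioc` and `negSecondDeriv_compl` for the properties that determine it. -/
noncomputable def negSecondDeriv (I : Set ℝ) (χ : ℝ → ℝ) : Measure ℝ :=
  (volume.restrict {s : ℝ | (∃ x ∈ I, negRightDeriv χ x < s) ∧ ∃ x ∈ I, s ≤ negRightDeriv χ x}).map
    (fun s => sInf {x : ℝ | x ∈ I ∧ s ≤ negRightDeriv χ x})

lemma negRightDeriv_monotoneOn {I : Set ℝ} {χ : ℝ → ℝ} (hI : IsOpen I) (hχ : ConcaveOn ℝ I χ) :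
    MonotoneOn (negRightDeriv χ) I := by
  have h := (hχ.neg).monotoneOn_rightDeriv
  rw [hI.interior_eq] at h
  exact h

/-- The right derivative of `-χ` is right-continuous. -/
lemma exists_lt_of_negRightDeriv_lt {I : Set ℝ} {χ : ℝ → ℝ} (hI : IsOpen I)
    (hχ : ConcaveOn ℝ I χ) {a s : ℝ} (ha : a ∈ I) (hs : negRightDeriv χ a < s) :
    ∃ c > a, ∀ x ∈ I, a < x → x < c → negRightDeriv χ x < s := by
  have hc : ConvexOn ℝ I (-χ) := hχ.neg
  have hai : a ∈ interior I := by rwa [hI.interior_eq]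
  have h1 : negRightDeriv χ a = sInf (slope (-χ) a '' {y | y ∈ I ∧ a < y}) :=
    hc.rightDeriv_eq_sInf_slope_of_mem_interior hai
  have hne : (slope (-χ) a '' {y | y ∈ I ∧ a < y}).Nonempty := by
    obtain ⟨ε, hε, hball⟩ := Metric.isOpen_iff.1 hI a ha
    refine Set.Nonempty.image _ ⟨a + ε / 2, hball ?_, by linarith⟩
    rw [Metric.mem_ball, Real.dist_eq, abs_lt]
    constructor <;> linarith
  rw [h1] at hs
  obtain ⟨_, ⟨y, ⟨hyI, hay⟩, rfl⟩, hlt⟩ := exists_lt_of_csInf_lt hne hs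
  have hcont : ContinuousAt (-χ) a := (hc.continuousOn hI).continuousAt (hI.mem_nhds ha)
  have hsl : ContinuousAt (fun x => slope (-χ) x y) a := by
    simp only [slope_def_field]
    exact (continuousAt_const.sub hcont).div (continuousAt_const.sub continuousAt_id)
      (by simpa using (sub_pos.2 hay).ne')
  have hev : ∀ᶠ x in 𝓝 a, slope (-χ) x y < s ∧ x < y :=
    (hsl.eventually (gt_mem_nhds hlt)).and (gt_mem_nhds hay)
  obtain ⟨ε, hε, hball⟩ := Metric.eventually_nhds_iff.1 hev
  refine ⟨a + ε, by linarith, fun x hxI hax hxc => ?_⟩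
  have hx := hball (y := x) (by rw [Real.dist_eq, abs_lt]; constructor <;> linarith)
  have hxi : x ∈ interior I := by rwa [hI.interior_eq]
  exact lt_of_le_of_lt (hc.rightDeriv_le_slope_of_mem_interior hxi hyI hx.2) hx.1

lemma negSecondDeriv_aemeasurable {I : Set ℝ} {χ : ℝ → ℝ} (hI : IsOpen I)
    (hχ : ConcaveOn ℝ I χ) :
    MeasurableSet {s : ℝ | (∃ x ∈ I, negRightDeriv χ x < s) ∧ ∃ x ∈ I, s ≤ negRightDeriv χ x} ∧
    AEMeasurable (fun s => sInf {x : ℝ | x ∈ I ∧ s ≤ negRightDeriv χ x}) (volume.restrict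
      {s : ℝ | (∃ x ∈ I, negRightDeriv χ x < s) ∧ ∃ x ∈ I, s ≤ negRightDeriv χ x}) := by
  have hS : MeasurableSet
      {s : ℝ | (∃ x ∈ I, negRightDeriv χ x < s) ∧ ∃ x ∈ I, s ≤ negRightDeriv χ x} := by
    apply Set.OrdConnected.measurableSet
    refine ⟨?_⟩
    rintro s ⟨⟨x, hx, hxs⟩, -⟩ t ⟨-, ⟨y, hy, hyt⟩⟩ r ⟨hsr, hrt⟩
    exact ⟨⟨x, hx, hxs.trans_le hsr⟩, ⟨y, hy, hrt.trans hyt⟩⟩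
  refine ⟨hS, aemeasurable_restrict_of_monotoneOn hS ?_⟩
  rintro s ⟨⟨y, hy, hys⟩, -⟩ t ⟨-, ⟨x, hx, hxt⟩⟩ hst
  refine csInf_le_csInf ⟨y, ?_⟩ ⟨x, hx, hxt⟩ fun z hz => ⟨hz.1, hst.trans hz.2⟩
  rintro z ⟨hz, hsz⟩
  by_contra! hlt
  exact absurd (negRightDeriv_monotoneOn hI hχ hz hy hlt.le) (not_le.2 (hys.trans_le hsz))

/-- The mass of `(a, b]` under `-χ''` is the increment of the right derivative of `-χ`. -/
theorem negSecondDeriv_Ioc {I : Set ℝ} {χ : ℝ → ℝ} (hI : IsOpen I) (hχ : ConcaveOn ℝ I χ)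
    {a b : ℝ} (ha : a ∈ I) (hb : b ∈ I) :
    negSecondDeriv I χ (Ioc a b) = ENNReal.ofReal (negRightDeriv χ b - negRightDeriv χ a) := by
  obtain ⟨hS, hT⟩ := negSecondDeriv_aemeasurable hI hχ
  have hmono := negRightDeriv_monotoneOn hI hχ
  have hab : ∀ {x y : ℝ}, x ∈ I → y ∈ I → negRightDeriv χ x < negRightDeriv χ y → x < y := by
    intro x y hx hy h
    by_contra! hle
    exact absurd (hmono hy hx hle) (not_le.2 h)
  rw [negSecondDeriv, Measure.map_apply_of_aemeasurable hT measurableSet_Ioc,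
    Measure.restrict_apply' hS, ← Real.volume_Ioc]
  congr 1
  ext s
  simp only [mem_inter_iff, mem_preimage, mem_Ioc, mem_ofPred_eq]
  constructor
  · rintro ⟨⟨h1, h2⟩, ⟨y, hy, hys⟩, ⟨x, hx, hsx⟩⟩
    have hbdd : BddBelow {x : ℝ | x ∈ I ∧ s ≤ negRightDeriv χ x} :=
      ⟨y, fun z hz => (hab hy hz.1 (hys.trans_le hz.2)).le⟩
    constructor
    · by_contra! hle
      exact absurd (csInf_le hbdd ⟨ha, hle⟩) (not_le.2 h1)
    · by_contra! hlt
      obtain ⟨c, hc, hcI⟩ := exists_lt_of_negRightDeriv_lt hI hχ hb hlt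
      have : c ≤ sInf {x : ℝ | x ∈ I ∧ s ≤ negRightDeriv χ x} := by
        refine le_csInf ⟨x, hx, hsx⟩ fun z hz => ?_
        by_contra! hzc
        exact absurd (hcI z hz.1 (hab hb hz.1 (hlt.trans_le hz.2)) hzc) (not_lt.2 hz.2)
      linarith
  · rintro ⟨h1, h2⟩
    have hbdd : BddBelow {x : ℝ | x ∈ I ∧ s ≤ negRightDeriv χ x} :=
      ⟨a, fun z hz => (hab ha hz.1 (h1.trans_le hz.2)).le⟩
    refine ⟨⟨?_, csInf_le hbdd ⟨hb, h2⟩⟩, ⟨a, ha, h1⟩, ⟨b, hb, h2⟩⟩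
    obtain ⟨c, hc, hcI⟩ := exists_lt_of_negRightDeriv_lt hI hχ ha h1
    have : c ≤ sInf {x : ℝ | x ∈ I ∧ s ≤ negRightDeriv χ x} := by
      refine le_csInf ⟨b, hb, h2⟩ fun z hz => ?_
      by_contra! hzc
      exact absurd (hcI z hz.1 (hab ha hz.1 (h1.trans_le hz.2)) hzc) (not_lt.2 hz.2)
    linarith

/-- The measure `-χ''` is concentrated on `I`. -/
theorem negSecondDeriv_compl {I : Set ℝ} {χ : ℝ → ℝ} (hI : IsOpen I) (hχ : ConcaveOn ℝ I χ) :
    negSecondDeriv I χ Iᶜ = 0 := by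
  obtain ⟨hS, hT⟩ := negSecondDeriv_aemeasurable hI hχ
  have hmono := negRightDeriv_monotoneOn hI hχ
  rw [negSecondDeriv, Measure.map_apply_of_aemeasurable hT hI.measurableSet.compl,
    Measure.restrict_apply' hS]
  convert measure_empty (μ := (volume : Measure ℝ))
  rw [Set.eq_empty_iff_forall_notMem]
  rintro s ⟨h, ⟨y, hy, hys⟩, ⟨x, hx, hsx⟩⟩
  have hle : ∀ z, z ∈ I → s ≤ negRightDeriv χ z → y ≤ z := by
    intro z hz hsz
    by_contra! hlt
    exact absurd (hmono hz hy hlt.le) (not_le.2 (hys.trans_le hsz))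
  refine h (hχ.1.ordConnected.out hy hx ⟨?_, ?_⟩)
  · exact le_csInf ⟨x, hx, hsx⟩ fun z hz => hle z hz.1 hz.2
  · exact csInf_le ⟨y, fun z hz => hle z hz.1 hz.2⟩ ⟨hx, hsx⟩

/-! ### The generalized integral `μ(φ) + ν(ψ)`

A function on `J` is represented by a function on `ℝ` of which only the values on `J` matter. -/

/-- `|Δχ|(b)`, the size of the jump of `χ` at an endpoint `b` of `I`. -/
noncomputable def jump (I : Set ℝ) (χ : ℝ → ℝ) (b : ℝ) : ℝ := |limUnder (𝓝[I] b) χ - χ b|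

/-- `(μ - ν)(χ) = ½ ∫_I (u_μ - u_ν) dχ'' + ∫_{J \ I} |Δχ| dν ∈ [0, ∞]` for a concave `χ` on `J`,
where the first integral is that of `u_ν - u_μ > 0` against the measure `-χ''`. -/
noncomputable def concaveIntegral (μ ν : Measure ℝ) (χ : ℝ → ℝ) : ℝ≥0∞ :=
  (1 / 2 : ℝ≥0∞) * ∫⁻ x in domI μ ν, ENNReal.ofReal (potential ν x - potential μ x)
      ∂(negSecondDeriv (domI μ ν) χ)
    + ∫⁻ b in domJ μ ν \ domI μ ν, ENNReal.ofReal (jump (domI μ ν) χ b) ∂ν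

/-- `φ + χ ∈ L¹(μ)` for `φ : J → [-∞, ∞]` and `χ : J → ℝ`: on `J`, the sum is finite
`μ`-almost everywhere (equivalently, `φ` is) and integrable. -/
def MemL1Add (μ : Measure ℝ) (J : Set ℝ) (φ : ℝ → EReal) (χ : ℝ → ℝ) : Prop :=
  (∀ᵐ x ∂(μ.restrict J), φ x ≠ ⊤ ∧ φ x ≠ ⊥) ∧ IntegrableOn (fun x => (φ x).toReal + χ x) J μ

/-- `χ : J → ℝ` is a concave moderator for `(φ, ψ)` with respect to `μ ≤_c ν`: it is concave,
`φ - χ ∈ L¹(μ)` and `ψ + χ ∈ L¹(ν)`. -/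
structure IsConcaveModerator (μ ν : Measure ℝ) (φ ψ : ℝ → EReal) (χ : ℝ → ℝ) : Prop where
  concave : ConcaveOn ℝ (domJ μ ν) χ
  left : MemL1Add μ (domJ μ ν) φ (fun x => -χ x)
  right : MemL1Add ν (domJ μ ν) ψ χ

/-- `μ(φ - χ) + ν(ψ + χ) + (μ - ν)(χ) ∈ (-∞, ∞]`. -/
noncomputable def moderatedIntegral (μ ν : Measure ℝ) (φ ψ : ℝ → EReal) (χ : ℝ → ℝ) : EReal :=
  ((∫ x in domJ μ ν, ((φ x).toReal - χ x) ∂μ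
      + ∫ x in domJ μ ν, ((ψ x).toReal + χ x) ∂ν : ℝ) : EReal)
    + (concaveIntegral μ ν χ : EReal)

open Classical in
/-- The generalized integral `μ(φ) + ν(ψ)`, defined as `moderatedIntegral` for a concave moderator of
`(φ, ψ)` (the value does not depend on which one; there is nothing to define if none exists). -/
noncomputable def genIntegral (μ ν : Measure ℝ) (φ ψ : ℝ → EReal) : EReal :=
  if h : ∃ χ : ℝ → ℝ, IsConcaveModerator μ ν φ ψ χ then moderatedIntegral μ ν φ ψ h.choose else 0

/-- `(φ, ψ) ∈ L^c(μ, ν)`: the functions `φ, ψ : J → [-∞, ∞]` are Borel and have a concave moderator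
`χ` with `(μ - ν)(χ) < ∞`. -/
structure MemLc (μ ν : Measure ℝ) (φ ψ : ℝ → EReal) : Prop where
  measurable_left : Measurable ((domJ μ ν).domRestrict φ)
  measurable_right : Measurable ((domJ μ ν).domRestrict ψ)
  moderator : ∃ χ : ℝ → ℝ, IsConcaveModerator μ ν φ ψ χ ∧ concaveIntegral μ ν χ < ⊤

/-! ### The auxiliary dual space -/

/-- `φ : J → [-∞, ∞]` is concave: its hypograph is convex. -/
def EConcaveOn (J : Set ℝ) (φ : ℝ → EReal) : Prop :=
  Convex ℝ {p : ℝ × ℝ | p.1 ∈ J ∧ (p.2 : EReal) ≤ φ p.1}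

/-- `ψ : J → [-∞, ∞]` is convex: its epigraph is convex. -/
def EConvexOn (J : Set ℝ) (ψ : ℝ → EReal) : Prop :=
  Convex ℝ {p : ℝ × ℝ | p.1 ∈ J ∧ ψ p.1 ≤ (p.2 : EReal)}

/-- The feasible set of the auxiliary dual problem of `f`: the pairs `(φ, ψ) ∈ L^c(μ, ν)` with
concave `φ`, convex `ψ` and `φ + ψ ≥ f` on `J`. -/
structure DualFeasible (μ ν : Measure ℝ) (f φ ψ : ℝ → EReal) : Prop where
  memLc : MemLc μ ν φ ψ
  concave : EConcaveOn (domJ μ ν) φ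
  convex : EConvexOn (domJ μ ν) ψ
  superhedge : ∀ x ∈ domJ μ ν, f x ≤ φ x + ψ x

end AuxDual

/-! A concave `φₙ` can serve as its own moderator, and the value becomes `(μ-ν)(φₙ) + ν(φₙ+ψₙ)`: two
nonnegative terms, both bounded along the sequence. The proof is a compactness argument for pairs
with such a bound, followed by Fatou's lemma for each of the two terms.

The link between the definition of `(μ-ν)(χ)` through `χ''` and integrals of `χ` is a martingale
kernel `κ` from `μ` to `ν` (Strassen). By Taylor's formula (`taylorRem_eq`) the gap between the
tangent of `χ` at `x` and `χ(y)` is an integral against `-χ''` plus a jump at the endpoints.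
Averaging it over `y` under `κ(x)` yields the Jensen gap `χ(x) - ∫ χ dκ(x)`, and averaging that over
`x` under `μ` yields `(μ-ν)(χ)` (`IsMartingaleKernel.concaveIntegral_eq`). From this follow the
change of moderator (`concaveIntegral_change`), invariance under adding affine functions, and lower
semicontinuity (`concaveIntegral_le_liminf`).

For compactness, the tangent of `φₙ` at a fixed `x₀ ∈ I` is subtracted from `φₙ` and added to `ψₙ`;
value and sum stay the same. The new `-φₙ` is a Taylor remainder, and at each `y ∈ J` it is at most
a constant times `(μ-ν)(φₙ)` (`exists_taylorRem_le`): the Taylor kernel is dominated by `u_ν - u_μ`,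
even up to an endpoint that is an atom of `ν`. The new `ψₙ` are then pointwise bounded, since their
sum with the new `φₙ` is bounded in `L¹(ν)` and `ν` charges both sides of every point of `I` as well
as the endpoints in `J` (`exists_bound_of_lintegral_le`). Helly's theorem gives a subsequence that
converges everywhere on `J`, so that the inequality `φ + ψ ≥ f` survives at every point. -/

namespace AuxDual

open scoped BoundedContinuousFunction CompactlySupported
open ProbabilityTheory

/-! ### Existence of martingale couplings -/

/-- A positive linear functional on the bounded continuous functions that is tight is the integral
with respect to a finite measure. -/
theorem exists_measure_of_positive_of_tight {X : Type*} [TopologicalSpace X] [T2Space X]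
    [LocallyCompactSpace X] [MeasurableSpace X] [BorelSpace X]
    (L : (X →ᵇ ℝ) →ₗ[ℝ] ℝ) (hpos : ∀ G : X →ᵇ ℝ, (∀ x, 0 ≤ G x) → 0 ≤ L G)
    (η : ℕ → C_c(X, ℝ)) (h0 : ∀ n x, 0 ≤ η n x) (h1 : ∀ n x, η n x ≤ 1)
    (hlim : ∀ x, Tendsto (fun n => η n x) atTop (𝓝 1))
    (ht : Tendsto (fun n => L (1 - (η n).toBoundedContinuousFunction)) atTop (𝓝 0)) :
    ∃ Q : Measure X, IsFiniteMeasure Q ∧ ∀ G : X →ᵇ ℝ, ∫ x, G x ∂Q = L G := by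
  have hmono : ∀ G H : X →ᵇ ℝ, (∀ x, G x ≤ H x) → L G ≤ L H := by
    intro G H h
    have := hpos (H - G) (fun x => by simpa using h x)
    rw [map_sub] at this
    linarith
  let Λ : C_c(X, ℝ) →ₚ[ℝ] ℝ :=
  { toFun := fun g => L g.toBoundedContinuousFunction
    map_add' := fun g g' => by rw [← map_add]; rfl
    map_smul' := fun c g => by rw [RingHom.id_apply, ← map_smul]; rfl
    monotone' := fun g g' h => hmono _ _ h }
  let Q := RealRMK.rieszMeasure Λ
  have hQ : ∀ g : C_c(X, ℝ), ∫ x, g x ∂Q = L g.toBoundedContinuousFunction :=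
    fun g => RealRMK.integral_rieszMeasure Λ g
  have hint : ∀ g : C_c(X, ℝ), Integrable g Q := fun g =>
    g.continuous.integrable_of_hasCompactSupport g.hasCompactSupport
  have hfin : IsFiniteMeasure Q := by
    -- Fatou along the cutoffs, whose integrals are at most `L 1`.
    refine ⟨?_⟩
    calc Q univ = ∫⁻ x, liminf (fun n => ENNReal.ofReal (η n x)) atTop ∂Q := by
          have : ∀ x, liminf (fun n => ENNReal.ofReal (η n x)) atTop = 1 := fun x => by
            have := (ENNReal.continuous_ofReal.tendsto 1).comp (hlim x)
            rw [ENNReal.ofReal_one] at this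
            exact this.liminf_eq
          simp [this]
      _ ≤ liminf (fun n => ∫⁻ x, ENNReal.ofReal (η n x) ∂Q) atTop :=
          lintegral_liminf_le (fun n => ((η n).continuous.measurable).ennreal_ofReal)
      _ ≤ ENNReal.ofReal (L 1) := by
          refine liminf_le_of_le (h := ?_)
          intro b hb
          obtain ⟨n, hn⟩ := hb.exists
          refine hn.trans ?_
          rw [← ofReal_integral_eq_lintegral_ofReal (hint _) (ae_of_all _ (h0 n)), hQ]
          exact ENNReal.ofReal_le_ofReal (hmono _ _ (h1 n))
      _ < ⊤ := ENNReal.ofReal_lt_top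
  refine ⟨Q, hfin, fun G => ?_⟩
  -- The integrals of the truncations `G ηₙ` tend to `∫ G dQ` by dominated convergence and to `L G`
  -- by tightness.
  let p : ℕ → C_c(X, ℝ) := fun n =>
    ⟨⟨fun x => G x * η n x, G.continuous.mul (η n).continuous⟩,
      (η n).hasCompactSupport.mul_left⟩
  have t1 : Tendsto (fun n => ∫ x, p n x ∂Q) atTop (𝓝 (∫ x, G x ∂Q)) := by
    refine tendsto_integral_of_dominated_convergence (fun _ => ‖G‖)
      (fun n => (p n).continuous.aestronglyMeasurable) (integrable_const _) ?_ ?_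
    · refine fun n => ae_of_all _ fun x => ?_
      have : ‖G x * η n x‖ ≤ ‖G‖ * 1 := by
        rw [norm_mul]
        gcongr
        · exact G.norm_coe_le_norm x
        · rw [Real.norm_eq_abs, abs_of_nonneg (h0 n x)]; exact h1 n x
      rwa [mul_one] at this
    · refine ae_of_all _ fun x => ?_
      have := (hlim x).const_mul (G x)
      rwa [mul_one] at this
  have t2 : Tendsto (fun n => ∫ x, p n x ∂Q) atTop (𝓝 (L G)) := by
    rw [tendsto_iff_dist_tendsto_zero]
    refine squeeze_zero (fun _ => dist_nonneg) (g := fun n =>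
      ‖G‖ * L (1 - (η n).toBoundedContinuousFunction)) (fun n => ?_) (by simpa using ht.const_mul ‖G‖)
    rw [hQ, Real.dist_eq, ← map_sub, ← smul_eq_mul, ← map_smul, abs_le, ← map_neg]
    have key : ∀ x, |G x * η n x - G x| ≤ ‖G‖ * (1 - η n x) := by
      intro x
      rw [← mul_sub_one, abs_mul, abs_sub_comm, abs_of_nonneg (sub_nonneg.2 (h1 n x))]
      exact mul_le_mul_of_nonneg_right (G.norm_coe_le_norm x) (sub_nonneg.2 (h1 n x))
    exact ⟨hmono _ _ fun x => (abs_le.1 (key x)).1, hmono _ _ fun x => (abs_le.1 (key x)).2⟩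
  exact tendsto_nhds_unique t1 t2

/-- Weak duality for martingale couplings. -/
lemma integral_add_integral_nonneg_of_convexOrder {μ ν : Measure ℝ} [IsFiniteMeasure ν]
    (hν : Integrable (fun x : ℝ => x) ν) (hc : ConvexOrder μ ν) {φ ψ h : ℝ → ℝ}
    (hφ : Integrable φ μ) (hψ : Integrable ψ ν)
    (H : ∀ x y, 0 ≤ φ x + ψ y + h x * (y - x)) : 0 ≤ ∫ x, φ x ∂μ + ∫ x, ψ x ∂ν := by
  -- A supremum of affine functions, hence convex, with `-φ ≤ χ ≤ ψ`: the lower bound is the choice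
  -- `x = y`, the upper one is `H`. The convex order applied to `χ` separates the two integrals.
  let χ : ℝ → ℝ := fun y => ⨆ x, (-φ x - h x * (y - x))
  have hb : ∀ y, BddAbove (range fun x => -φ x - h x * (y - x)) := fun y =>
    ⟨ψ y, by rintro _ ⟨x, rfl⟩; linarith [H x y]⟩
  have hge : ∀ x y, -φ x - h x * (y - x) ≤ χ y := fun x y => le_ciSup (hb y) x
  have hle : ∀ y, χ y ≤ ψ y := fun y => ciSup_le fun x => by linarith [H x y]
  have hconv : ConvexOn ℝ univ χ := by
    refine ⟨convex_univ, fun y _ z _ a b ha hb hab => ciSup_le fun x => ?_⟩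
    have h1 := mul_le_mul_of_nonneg_left (hge x y) ha
    have h2 := mul_le_mul_of_nonneg_left (hge x z) hb
    simp only [smul_eq_mul] at *
    have : -φ x - h x * (a * y + b * z - x) =
        a * (-φ x - h x * (y - x)) + b * (-φ x - h x * (z - x)) := by
      obtain rfl : b = 1 - a := by linarith
      ring
    linarith
  have hcont : Continuous χ := continuousOn_univ.1 (hconv.continuousOn isOpen_univ)
  have hint : Integrable χ ν := by
    refine MeasureTheory.Integrable.mono' (g := fun y => |ψ y| + |-φ 0 - h 0 * (y - 0)|)
      (hψ.abs.add ?_) hcont.aestronglyMeasurable (ae_of_all _ fun y => ?_)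
    · exact ((integrable_const _).sub ((hν.sub (integrable_const _)).const_mul _)).abs
    · rw [Real.norm_eq_abs, abs_le]
      constructor
      · linarith [hge 0 y, neg_abs_le (-φ 0 - h 0 * (y - 0)), abs_nonneg (ψ y)]
      · linarith [hle y, le_abs_self (ψ y), abs_nonneg (-φ 0 - h 0 * (y - 0))]
  obtain ⟨i1, i2⟩ := hc χ hconv hint
  have i3 : ∫ x, χ x ∂ν ≤ ∫ x, ψ x ∂ν := integral_mono hint hψ hle
  have i4 : ∫ x, -φ x ∂μ ≤ ∫ x, χ x ∂μ :=
    integral_mono hφ.neg i1 fun x => by simpa using hge x x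
  rw [integral_neg] at i4
  linarith

/-! ### Superhedging prices and the Hahn–Banach theorem -/

/-- The values of the superhedging prices for the claim `(1 + |x| + |y|) G(x, y)`. -/
def superhedgePrices (μ ν : Measure ℝ) (G : ℝ × ℝ →ᵇ ℝ) : Set ℝ :=
  {r | ∃ φ ψ h : ℝ → ℝ, Integrable φ μ ∧ Integrable ψ ν ∧
    (∀ x y, (1 + |x| + |y|) * G (x, y) ≤ φ x + ψ y + h x * (y - x)) ∧
    r = ∫ x, φ x ∂μ + ∫ x, ψ x ∂ν}

/-- A positive functional that is dominated by all superhedging prices. -/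
lemma exists_functional_le_superhedgePrices {μ ν : Measure ℝ} [IsFiniteMeasure μ]
    [IsFiniteMeasure ν] (hμ : Integrable (fun x : ℝ => x) μ) (hν : Integrable (fun x : ℝ => x) ν)
    (hc : ConvexOrder μ ν) :
    ∃ L : (ℝ × ℝ →ᵇ ℝ) →ₗ[ℝ] ℝ, ∀ G, ∀ r ∈ superhedgePrices μ ν G, L G ≤ r := by
  have hne : ∀ G, (superhedgePrices μ ν G).Nonempty := fun G => by
    refine ⟨_, fun x => ‖G‖ * (1 + |x|), fun y => ‖G‖ * |y|, 0,
      ((integrable_const _).add hμ.abs).const_mul _, hν.abs.const_mul _, fun x y => ?_, rfl⟩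
    have := mul_le_mul_of_nonneg_left ((le_abs_self _).trans (G.norm_coe_le_norm (x, y)))
      (show 0 ≤ 1 + |x| + |y| by positivity)
    simp only [Pi.zero_apply]
    linarith
  have hbdd : ∀ G, BddBelow (superhedgePrices μ ν G) := fun G => by
    refine ⟨-(∫ x, ‖G‖ * (1 + |x|) ∂μ + ∫ x, ‖G‖ * |x| ∂ν), ?_⟩
    rintro _ ⟨φ, ψ, h, hφ, hψ, H, rfl⟩
    have i1 : Integrable (fun x => ‖G‖ * (1 + |x|)) μ :=
      ((integrable_const _).add hμ.abs).const_mul _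
    have i2 : Integrable (fun x => ‖G‖ * |x|) ν := hν.abs.const_mul _
    have := integral_add_integral_nonneg_of_convexOrder (h := h) hν hc (hφ.add i1) (hψ.add i2)
      (fun x y => by
        have h1 := mul_le_mul_of_nonneg_left
          (abs_le.1 ((Real.norm_eq_abs _).symm.le.trans (G.norm_coe_le_norm (x, y)))).1
          (show 0 ≤ 1 + |x| + |y| by positivity)
        have := H x y
        simp only [Pi.add_apply]
        nlinarith)
    simp only [Pi.add_apply] at this
    rw [integral_add hφ i1, integral_add hψ i2] at this
    linarith
  -- The superhedging price is sublinear; it is finite because of weak duality. Hahn–Banach extends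
  -- the zero functional on the trivial subspace to a linear functional below it.
  let N : (ℝ × ℝ →ᵇ ℝ) → ℝ := fun G => sInf (superhedgePrices μ ν G)
  have hsmul : ∀ c : ℝ, 0 < c → ∀ G, N (c • G) ≤ c * N G := by
    intro c hc G
    rw [← div_le_iff₀' hc]
    refine le_csInf (hne G) ?_
    rintro _ ⟨φ, ψ, h, hφ, hψ, H, rfl⟩
    rw [div_le_iff₀' hc]
    refine csInf_le (hbdd _) ⟨fun x => c * φ x, fun x => c * ψ x, fun x => c * h x,
      hφ.const_mul _, hψ.const_mul _, fun x y => ?_, ?_⟩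
    · have := mul_le_mul_of_nonneg_left (H x y) hc.le
      simp only [BoundedContinuousFunction.coe_smul, smul_eq_mul]
      linarith
    · rw [integral_const_mul, integral_const_mul]; ring
  have N_hom : ∀ c : ℝ, 0 < c → ∀ G, N (c • G) = c * N G := by
    intro c hc G
    refine le_antisymm (hsmul c hc G) ?_
    have := hsmul c⁻¹ (inv_pos.2 hc) (c • G)
    rw [smul_smul, inv_mul_cancel₀ hc.ne', one_smul] at this
    rwa [← le_inv_mul_iff₀ hc]
  have N_add : ∀ G H, N (G + H) ≤ N G + N H := by
    intro G H
    rw [← sub_le_iff_le_add]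
    refine le_csInf (hne G) ?_
    rintro _ ⟨φ, ψ, h, hφ, hψ, h1, rfl⟩
    rw [sub_le_comm]
    refine le_csInf (hne H) ?_
    rintro _ ⟨φ', ψ', h', hφ', hψ', h2, rfl⟩
    rw [sub_le_iff_le_add]
    refine csInf_le (hbdd _) ⟨fun x => φ x + φ' x, fun x => ψ x + ψ' x, fun x => h x + h' x,
      hφ.add hφ', hψ.add hψ', fun x y => ?_, ?_⟩
    · have := h1 x y
      have := h2 x y
      simp only [BoundedContinuousFunction.coe_add, Pi.add_apply]
      linarith
    · rw [integral_add hφ hφ', integral_add hψ hψ']; ring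
  obtain ⟨L, -, hL⟩ := exists_extension_of_le_sublinear (⊥ : (ℝ × ℝ →ᵇ ℝ) →ₗ.[ℝ] ℝ) N N_hom N_add
    (by
      rintro ⟨x, hx⟩
      obtain rfl : x = 0 := (Submodule.mem_bot ℝ).1 hx
      have h0 : N 0 = 0 := by
        have := N_hom 2 two_pos 0
        rw [smul_zero] at this
        linarith
      have : (⊥ : (ℝ × ℝ →ᵇ ℝ) →ₗ.[ℝ] ℝ) ⟨0, hx⟩ = 0 := LinearPMap.map_zero _
      rw [this, h0])
  exact ⟨L, fun G r hr => (hL G).trans (csInf_le (hbdd G) hr)⟩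

/-- A continuous cutoff function on the plane. -/
noncomputable def planeCutoff (n : ℕ) : C_c(ℝ × ℝ, ℝ) where
  toFun p := max 0 (min 1 (n + 1 - ‖p‖))
  continuous_toFun := by fun_prop
  hasCompactSupport' := by
    refine HasCompactSupport.of_support_subset_isCompact
      (isCompact_closedBall (0 : ℝ × ℝ) (n + 1)) fun p hp => ?_
    rw [mem_closedBall_zero_iff]
    by_contra! h
    refine hp (max_eq_left ((min_le_right _ _).trans ?_))
    linarith

lemma planeCutoff_nonneg (n : ℕ) (p : ℝ × ℝ) : 0 ≤ planeCutoff n p := le_max_left _ _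

lemma planeCutoff_le_one (n : ℕ) (p : ℝ × ℝ) : planeCutoff n p ≤ 1 :=
  max_le zero_le_one (min_le_left _ _)

lemma planeCutoff_eq_one {n : ℕ} {p : ℝ × ℝ} (h : ‖p‖ ≤ n) : planeCutoff n p = 1 := by
  change max 0 (min 1 ((n : ℝ) + 1 - ‖p‖)) = 1
  rw [min_eq_left (by linarith), max_eq_right zero_le_one]

/-- Where `|y| ≤ |x|`, the weight `1 + |x| + |y|` is at most `1 + 2|x|`. These tails therefore
superhedge the weight outside a large ball at a vanishing price, which is the tightness needed for
the Riesz representation. -/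
lemma tendsto_integral_tail {μ : Measure ℝ} [IsFiniteMeasure μ]
    (hμ : Integrable (fun x : ℝ => x) μ) :
    (∀ n : ℕ, Integrable ({x : ℝ | (n : ℝ) < |x|}.indicator fun x => 1 + 2 * |x|) μ) ∧
    Tendsto (fun n : ℕ => ∫ x, {x : ℝ | (n : ℝ) < |x|}.indicator (fun x => 1 + 2 * |x|) x ∂μ) atTop
      (𝓝 0) := by
  have hm : ∀ n : ℕ, MeasurableSet {x : ℝ | (n : ℝ) < |x|} := fun n =>
    measurableSet_lt measurable_const measurable_id.abs
  have hi : Integrable (fun x : ℝ => 1 + 2 * |x|) μ := (integrable_const _).add (hμ.abs.const_mul _)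
  refine ⟨fun n => hi.indicator (hm n), ?_⟩
  have := tendsto_integral_of_dominated_convergence (μ := μ) (f := fun _ => (0 : ℝ))
    (F := fun (n : ℕ) x => {x : ℝ | (n : ℝ) < |x|}.indicator (fun x => 1 + 2 * |x|) x)
    (fun x => 1 + 2 * |x|) (fun n => (hi.indicator (hm n)).aestronglyMeasurable) hi
    (fun n => ae_of_all _ fun x => ?_) (ae_of_all _ fun x => ?_)
  · simpa using this
  · refine (norm_indicator_le_norm_self _ _).trans ?_
    rw [Real.norm_eq_abs, abs_of_nonneg (by positivity)]
  · obtain ⟨n, hn⟩ := exists_nat_ge |x|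
    refine tendsto_const_nhds.congr' ?_
    filter_upwards [eventually_ge_atTop n] with m hm
    rw [indicator_of_notMem]
    simp only [mem_ofPred_eq, not_lt]
    exact hn.trans (by exact_mod_cast hm)

/-- **Strassen's theorem** on the line: measures in convex order have a martingale coupling. -/
theorem exists_martingale_coupling {μ ν : Measure ℝ} [IsFiniteMeasure μ] [IsFiniteMeasure ν]
    (hμ : Integrable (fun x : ℝ => x) μ) (hν : Integrable (fun x : ℝ => x) ν)
    (hc : ConvexOrder μ ν) :
    ∃ P : Measure (ℝ × ℝ), IsFiniteMeasure P ∧ P.fst = μ ∧ P.snd = ν ∧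
      ∀ h : ℝ →ᵇ ℝ, ∫ p, h p.1 * (p.2 - p.1) ∂P = 0 := by
  obtain ⟨L, hL⟩ := exists_functional_le_superhedgePrices hμ hν hc
  have hpos : ∀ G : ℝ × ℝ →ᵇ ℝ, (∀ x, 0 ≤ G x) → 0 ≤ L G := by
    intro G hG
    have := hL (-G) 0 ⟨0, 0, 0, integrable_zero _ _ _, integrable_zero _ _ _, fun x y => ?_, by simp⟩
    · rw [map_neg] at this
      linarith
    · have := mul_nonneg (show 0 ≤ 1 + |x| + |y| by positivity) (hG (x, y))
      simp only [BoundedContinuousFunction.coe_neg, Pi.neg_apply, Pi.zero_apply]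
      linarith
  obtain ⟨Q, hQfin, hQ⟩ := exists_measure_of_positive_of_tight L hpos planeCutoff
    planeCutoff_nonneg planeCutoff_le_one
    (fun p => by
      obtain ⟨n, hn⟩ := exists_nat_ge ‖p‖
      refine tendsto_const_nhds.congr' ?_
      filter_upwards [eventually_ge_atTop n] with m hm
      rw [planeCutoff_eq_one (hn.trans (by exact_mod_cast hm))])
    (by
      obtain ⟨i1, t1⟩ := tendsto_integral_tail hμ
      obtain ⟨i2, t2⟩ := tendsto_integral_tail hν
      refine squeeze_zero (fun n => hpos _ fun p => ?_) (fun n => hL _ _ ⟨_, _, 0, i1 n, i2 n, ?_, rfl⟩)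
        (by simpa using t1.add t2)
      · simpa using planeCutoff_le_one n p
      · intro x y
        have nn : ∀ z : ℝ, 0 ≤ {x : ℝ | (n : ℝ) < |x|}.indicator (fun x => 1 + 2 * |x|) z :=
          fun z => indicator_nonneg (fun x _ => by positivity) z
        simp only [BoundedContinuousFunction.coe_sub, BoundedContinuousFunction.coe_one,
          Pi.sub_apply, Pi.one_apply, Pi.zero_apply, zero_mul, add_zero,
          CompactlySupportedContinuousMap.toBoundedContinuousFunction_apply]
        have hw : (1 + |x| + |y|) * (1 - planeCutoff n (x, y)) ≤ 1 + |x| + |y| := by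
          have := planeCutoff_nonneg n (x, y)
          have : 0 ≤ 1 + |x| + |y| := by positivity
          nlinarith
        by_cases hxy : ‖(x, y)‖ ≤ n
        · rw [planeCutoff_eq_one hxy]
          linarith [nn x, nn y]
        -- Outside the ball the larger of `|x|` and `|y|` exceeds `n`, and its tail function alone
        -- covers the weight.
        · rw [Prod.norm_def, Real.norm_eq_abs, Real.norm_eq_abs, not_le, lt_max_iff] at hxy
          rcases le_total |x| |y| with h | h
          · have hy : (n : ℝ) < |y| := by rcases hxy with h' | h' <;> linarith
            have : {x : ℝ | (n : ℝ) < |x|}.indicator (fun x => 1 + 2 * |x|) y = 1 + 2 * |y| :=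
              indicator_of_mem (show y ∈ {x : ℝ | (n : ℝ) < |x|} from hy) _
            linarith [nn x]
          · have hx : (n : ℝ) < |x| := by rcases hxy with h' | h' <;> linarith
            have : {x : ℝ | (n : ℝ) < |x|}.indicator (fun x => 1 + 2 * |x|) x = 1 + 2 * |x| :=
              indicator_of_mem (show x ∈ {x : ℝ | (n : ℝ) < |x|} from hx) _
            linarith [nn y])
  let w : ℝ × ℝ → ℝ := fun p => 1 + |p.1| + |p.2|
  have hw1 : ∀ p, 1 ≤ w p := fun p => by
    simp only [w]; linarith [abs_nonneg p.1, abs_nonneg p.2]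
  have hwpos : ∀ p, 0 < w p := fun p => zero_lt_one.trans_le (hw1 p)
  have hwc : Continuous w := by fun_prop
  have hwic : Continuous fun p => (w p)⁻¹ := hwc.inv₀ fun p => (hwpos p).ne'
  -- `Q` represents `G ↦ L G`, where `G` stands for the claim `w G`. Dividing by `w` gives the
  -- coupling and makes claims of linear growth, such as `h(x)(y - x)`, accessible.
  let P : Measure (ℝ × ℝ) := Q.withDensity fun p => ENNReal.ofReal (w p)⁻¹
  have hP : ∀ F : ℝ × ℝ → ℝ, ∫ p, F p ∂P = ∫ p, F p * (w p)⁻¹ ∂Q := by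
    intro F
    rw [integral_withDensity_eq_integral_toReal_smul (hwic.measurable.ennreal_ofReal)
      (ae_of_all _ fun p => ENNReal.ofReal_lt_top)]
    refine integral_congr_ae (ae_of_all _ fun p => ?_)
    simp only
    rw [ENNReal.toReal_ofReal (inv_nonneg.2 (hwpos p).le), smul_eq_mul, mul_comm]
  have hPfin : IsFiniteMeasure P := by
    refine isFiniteMeasure_withDensity (lt_of_le_of_lt (b := ∫⁻ _, 1 ∂Q) ?_ (by simp)).ne
    refine lintegral_mono fun p => ?_
    rw [← ENNReal.ofReal_one]
    exact ENNReal.ofReal_le_ofReal (inv_le_one_of_one_le₀ (hw1 p))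
  -- A claim that is hedged exactly has its value pinned down: the price bounds for `F` and `-F`
  -- coincide. The marginals and the martingale property are three instances.
  have key : ∀ (F : ℝ × ℝ → ℝ) (C : ℝ) (φ ψ h : ℝ → ℝ), Continuous F → (∀ p, |F p| ≤ C * w p) →
      Integrable φ μ → Integrable ψ ν → (∀ x y, F (x, y) = φ x + ψ y + h x * (y - x)) →
      ∫ p, F p ∂P = ∫ x, φ x ∂μ + ∫ x, ψ x ∂ν := by
    intro F C φ ψ h hF hC hφ hψ H
    let G : ℝ × ℝ →ᵇ ℝ := BoundedContinuousFunction.ofNormedAddCommGroup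
      (fun p => F p * (w p)⁻¹) (hF.mul hwic) C fun p => by
        rw [Real.norm_eq_abs, abs_mul, abs_of_pos (inv_pos.2 (hwpos p)), ← div_eq_mul_inv,
          div_le_iff₀ (hwpos p)]
        exact hC p
    have hG : ∀ x y, (1 + |x| + |y|) * G (x, y) = F (x, y) := fun x y => by
      change w (x, y) * (F (x, y) * (w (x, y))⁻¹) = F (x, y)
      rw [mul_comm, mul_assoc, inv_mul_cancel₀ (hwpos _).ne', mul_one]
    rw [hP]
    change ∫ p, G p ∂Q = _
    rw [hQ]
    refine le_antisymm (hL _ _ ⟨φ, ψ, h, hφ, hψ, fun x y => by rw [hG, H], rfl⟩) ?_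
    have := hL (-G) _ ⟨-φ, -ψ, -h, hφ.neg, hψ.neg, fun x y => ?_, rfl⟩
    · simp only [Pi.neg_apply, integral_neg, map_neg] at this
      linarith
    · have e := hG x y
      rw [H] at e
      simp only [BoundedContinuousFunction.coe_neg, Pi.neg_apply]
      linarith
  have hbound : ∀ (f : ℝ →ᵇ ℝ) (p : ℝ × ℝ) x, |f x| ≤ ‖f‖ * w p := fun f p x =>
    (f.norm_coe_le_norm x).trans (le_mul_of_one_le_right (norm_nonneg _) (hw1 p))
  refine ⟨P, hPfin, ?_, ?_, fun h => ?_⟩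
  · refine ext_of_forall_integral_eq_of_IsFiniteMeasure fun f => ?_
    rw [Measure.fst, integral_map measurable_fst.aemeasurable f.continuous.aestronglyMeasurable,
      key (fun p => f p.1) ‖f‖ f 0 0 (f.continuous.comp continuous_fst) (fun p => hbound f p _)
        (f.integrable μ) (integrable_zero _ _ _) (fun x y => by simp)]
    simp
  · refine ext_of_forall_integral_eq_of_IsFiniteMeasure fun f => ?_
    rw [Measure.snd, integral_map measurable_snd.aemeasurable f.continuous.aestronglyMeasurable,
      key (fun p => f p.2) ‖f‖ 0 f 0 (f.continuous.comp continuous_snd) (fun p => hbound f p _)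
        (integrable_zero _ _ _) (f.integrable ν) (fun x y => by simp)]
    simp
  · rw [key (fun p => h p.1 * (p.2 - p.1)) ‖h‖ 0 0 h (by fun_prop) (fun p => ?_)
      (integrable_zero _ _ _) (integrable_zero _ _ _) (fun x y => by simp)]
    · simp
    · rw [abs_mul]
      refine mul_le_mul (h.norm_coe_le_norm _) ?_ (abs_nonneg _) (norm_nonneg _)
      simp only [w]
      linarith [abs_sub p.2 p.1]

/-- A martingale kernel transporting `μ` to `ν`. -/
structure IsMartingaleKernel (μ ν : Measure ℝ) (κ : Kernel ℝ ℝ) : Prop where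
  markov : IsMarkovKernel κ
  snd_eq : (μ ⊗ₘ κ).snd = ν
  integrable : ∀ᵐ x ∂μ, Integrable (fun y : ℝ => y) (κ x)
  mean : ∀ᵐ x ∂μ, ∫ y, y ∂κ x = x

/-- Disintegration of the martingale coupling. Testing with `g(x)(y - x)` for smooth compactly
supported `g` forces the conditional mean of `y - x` to vanish almost everywhere. -/
theorem exists_isMartingaleKernel {μ ν : Measure ℝ} [IsFiniteMeasure μ] [IsFiniteMeasure ν]
    (hμ : Integrable (fun x : ℝ => x) μ) (hν : Integrable (fun x : ℝ => x) ν)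
    (hc : ConvexOrder μ ν) : ∃ κ : Kernel ℝ ℝ, IsMartingaleKernel μ ν κ := by
  obtain ⟨P, hfin, rfl, rfl, hmart⟩ := exists_martingale_coupling hμ hν hc
  have hdis : P.fst ⊗ₘ P.condKernel = P := P.disintegrate P.condKernel
  have i1 : Integrable (fun p : ℝ × ℝ => p.1) P := by
    rw [Measure.fst] at hμ
    exact hμ.comp_measurable measurable_fst
  have i2 : Integrable (fun p : ℝ × ℝ => p.2) P := by
    rw [Measure.snd] at hν
    exact hν.comp_measurable measurable_snd
  have i3 := i2.sub i1
  have i2' := i2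
  rw [← hdis] at i2' i3
  have ha := ((Measure.integrable_compProd_iff i2'.aestronglyMeasurable).1 i2').1
  have hm : Integrable (fun x => ∫ y, (y - x) ∂P.condKernel x) P.fst := by
    rw [Measure.compProd] at i3
    exact MeasureTheory.Integrable.integral_compProd i3
  have hz : ∀ᵐ x ∂P.fst, ∫ y, (y - x) ∂P.condKernel x = 0 := by
    refine ae_eq_zero_of_integral_contDiff_smul_eq_zero hm.locallyIntegrable fun g hg hs => ?_
    obtain ⟨C, hC⟩ := hs.exists_bound_of_continuous hg.continuous
    have h0 := hmart (BoundedContinuousFunction.ofNormedAddCommGroup g hg.continuous C hC)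
    simp only [BoundedContinuousFunction.coe_ofNormedAddCommGroup] at h0
    have ig : Integrable (fun p : ℝ × ℝ => g p.1 * (p.2 - p.1)) (P.fst ⊗ₘ P.condKernel) :=
      i3.bdd_mul (hg.continuous.comp continuous_fst).aestronglyMeasurable
        (ae_of_all _ fun p => hC p.1)
    rw [← hdis, Measure.integral_compProd ig] at h0
    simpa only [smul_eq_mul, integral_const_mul] using h0
  refine ⟨P.condKernel, inferInstance, by rw [hdis], ha, ?_⟩
  filter_upwards [hz, ha] with x h1 h2
  rw [integral_sub h2 (integrable_const _)] at h1
  simp at h1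
  linarith

/-! ### Taylor's formula for concave functions -/

instance (I : Set ℝ) (χ : ℝ → ℝ) : SFinite (negSecondDeriv I χ) := by
  unfold negSecondDeriv; infer_instance

/-- The kernel of the integral remainder in Taylor's formula. -/
noncomputable def taylorKernel (x y z : ℝ) : ℝ := if x < z then max (y - z) 0 else max (z - y) 0

lemma taylorKernel_nonneg (x y z : ℝ) : 0 ≤ taylorKernel x y z := by
  unfold taylorKernel; split_ifs <;> exact le_max_right _ _

lemma measurable_taylorKernel :
    Measurable fun p : (ℝ × ℝ) × ℝ => taylorKernel p.1.1 p.1.2 p.2 := by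
  unfold taylorKernel
  refine Measurable.ite (measurableSet_lt (by fun_prop) (by fun_prop)) ?_ ?_ <;> fun_prop

lemma continuous_taylorKernel_mid (x z : ℝ) : Continuous fun y => taylorKernel x y z := by
  unfold taylorKernel
  split_ifs <;> fun_prop

/-- Supplies the dominating function when `y'` tends along the segment to an endpoint `y`. -/
lemma taylorKernel_le_of_mem_segment {x y y' : ℝ} (h : y' ∈ uIcc x y) (z : ℝ) :
    taylorKernel x y' z ≤ taylorKernel x y z := by
  unfold taylorKernel
  rw [mem_uIcc] at h
  split_ifs with hz
  · refine max_le ?_ (le_max_right _ _)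
    rcases h with h | h
    · exact (by linarith : y' - z ≤ y - z).trans (le_max_left _ _)
    · exact (by linarith : y' - z ≤ 0).trans (le_max_right _ _)
  · refine max_le ?_ (le_max_right _ _)
    rcases h with h | h
    · exact (by linarith : z - y' ≤ 0).trans (le_max_right _ _)
    · exact (by linarith : z - y' ≤ z - y).trans (le_max_left _ _)

/-- In this form the last term has mean zero under a martingale coupling, and the first two
integrate to half the difference of the potentials. -/
lemma taylorKernel_eq (x y z : ℝ) : taylorKernel x y z =
    (|z - y| - |z - x| + (if x < z then 1 else -1) * (y - x)) / 2 := by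
  unfold taylorKernel
  split_ifs with h
  · rw [abs_of_pos (sub_pos.2 h)]
    rcases le_total y z with h' | h'
    · rw [max_eq_right (by linarith), abs_of_nonneg (by linarith)]; ring
    · rw [max_eq_left (by linarith), abs_of_nonpos (by linarith)]; ring
  · rw [abs_of_nonpos (show z - x ≤ 0 by linarith)]
    rcases le_total y z with h' | h'
    · rw [max_eq_left (by linarith), abs_of_nonneg (by linarith)]; ring
    · rw [max_eq_right (by linarith), abs_of_nonpos (by linarith)]; ring

/-- Taylor's remainder of a concave function. -/
noncomputable def taylorGap (χ : ℝ → ℝ) (x y : ℝ) : ℝ :=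
  χ x - χ y - negRightDeriv χ x * (y - x)

lemma lintegral_negSecondDeriv_restrict {I : Set ℝ} {χ : ℝ → ℝ} (hI : IsOpen I)
    (hχ : ConcaveOn ℝ I χ) (f : ℝ → ℝ≥0∞) :
    ∫⁻ z in I, f z ∂negSecondDeriv I χ = ∫⁻ z, f z ∂negSecondDeriv I χ := by
  rw [Measure.restrict_eq_self_of_ae_mem]
  rw [ae_iff]
  exact negSecondDeriv_compl hI hχ

lemma integral_negRightDeriv {I : Set ℝ} {χ : ℝ → ℝ} (hI : IsOpen I)
    (hχ : ConcaveOn ℝ I χ) {x y : ℝ} (hx : x ∈ I) (hy : y ∈ I) :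
    IntervalIntegrable (negRightDeriv χ) volume x y ∧
      ∫ t in x..y, negRightDeriv χ t = χ x - χ y := by
  have hsub : uIcc x y ⊆ I := hχ.1.ordConnected.uIcc_subset hx hy
  have hint : IntervalIntegrable (negRightDeriv χ) volume x y :=
    ((negRightDeriv_monotoneOn hI hχ).mono hsub).intervalIntegrable
  refine ⟨hint, ?_⟩
  rw [intervalIntegral.integral_eq_sub_of_hasDeriv_right (f := fun t => -χ t) _ _ hint]
  · ring
  · exact ((hχ.continuousOn hI).mono hsub).neg
  · intro t ht
    refine (hχ.neg).hasDerivWithinAt_rightDeriv_of_mem_interior ?_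
    rw [hI.interior_eq]
    exact hsub (Ioo_subset_Icc_self ht)

/-- With `g` the right derivative of `-χ`, the gap is the integral of `g(t) - g(x)` over `t` from
`x` to `y`. The increments of `g` are masses of half-open intervals, `(x, t]` or `(t, x]`, and
Tonelli's theorem exchanges `t` and `z`. The half-open intervals account for the strict inequality
`x < z` in the kernel. -/
lemma lintegral_taylorKernel {I : Set ℝ} {χ : ℝ → ℝ} (hI : IsOpen I)
    (hχ : ConcaveOn ℝ I χ) {x y : ℝ} (hx : x ∈ I) (hy : y ∈ I) :
    0 ≤ taylorGap χ x y ∧ ∫⁻ z in I, ENNReal.ofReal (taylorKernel x y z) ∂negSecondDeriv I χ =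
      ENNReal.ofReal (taylorGap χ x y) := by
  rw [lintegral_negSecondDeriv_restrict hI hχ]
  obtain ⟨hint, heq⟩ := integral_negRightDeriv hI hχ hx hy
  have hmono := negRightDeriv_monotoneOn hI hχ
  have hsub : uIcc x y ⊆ I := hχ.1.ordConnected.uIcc_subset hx hy
  have hgap : taylorGap χ x y = ∫ t in x..y, (negRightDeriv χ t - negRightDeriv χ x) := by
    rw [intervalIntegral.integral_sub hint intervalIntegrable_const, heq, taylorGap,
      intervalIntegral.integral_const, smul_eq_mul]
    ring
  rcases le_total x y with hxy | hxy
  · rw [uIcc_of_le hxy] at hsub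
    have hnn : ∀ t ∈ Ioc x y, 0 ≤ negRightDeriv χ t - negRightDeriv χ x := fun t ht =>
      sub_nonneg.2 (hmono hx (hsub (Ioc_subset_Icc_self ht)) ht.1.le)
    have hae : 0 ≤ᵐ[volume.restrict (Ioc x y)] fun t => negRightDeriv χ t - negRightDeriv χ x :=
      (ae_restrict_mem measurableSet_Ioc).mono hnn
    rw [intervalIntegral.integral_of_le hxy] at hgap
    refine ⟨hgap ▸ integral_nonneg_of_ae hae, ?_⟩
    rw [hgap, ofReal_integral_eq_lintegral_ofReal
      ((hint.sub intervalIntegrable_const).1) hae]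
    calc ∫⁻ z, ENNReal.ofReal (taylorKernel x y z) ∂negSecondDeriv I χ
        = ∫⁻ z, (∫⁻ t in Ioc x y, (Ioc x t).indicator 1 z) ∂negSecondDeriv I χ := by
          refine lintegral_congr fun z => ?_
          have : ∀ t, (Ioc x t).indicator (1 : ℝ → ℝ≥0∞) z =
              ({t | x < z ∧ z ≤ t}).indicator 1 t := fun t => by
            simp only [indicator_apply, mem_Ioc, mem_ofPred_eq, Pi.one_apply]
          simp only [this]
          rw [lintegral_indicator_one (s := {t | x < z ∧ z ≤ t})
            ((MeasurableSet.const (x < z)).inter measurableSet_Ici),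
          Measure.restrict_apply' measurableSet_Ioc, taylorKernel]
          split_ifs with h
          · have : {t | x < z ∧ z ≤ t} ∩ Ioc x y = Icc z y := by
              ext t; simp only [mem_inter_iff, mem_ofPred_eq, mem_Ioc, mem_Icc]
              constructor
              · rintro ⟨⟨-, h1⟩, -, h2⟩; exact ⟨h1, h2⟩
              · rintro ⟨h1, h2⟩; exact ⟨⟨h, h1⟩, h.trans_le h1, h2⟩
            rw [this, Real.volume_Icc, ENNReal.ofReal_max]
            simp
          · simp only [h, false_and]
            rw [max_eq_right (by linarith)]
            simp
      _ = ∫⁻ t in Ioc x y, (∫⁻ z, (Ioc x t).indicator 1 z ∂negSecondDeriv I χ) := by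
          refine lintegral_lintegral_swap (Measurable.aemeasurable ?_)
          have : MeasurableSet {p : ℝ × ℝ | x < p.1 ∧ p.1 ≤ p.2} :=
            (measurableSet_lt measurable_const measurable_fst).inter
              (measurableSet_le measurable_fst measurable_snd)
          exact (measurable_one.indicator this : Measurable
            ({p : ℝ × ℝ | x < p.1 ∧ p.1 ≤ p.2}.indicator (1 : ℝ × ℝ → ℝ≥0∞)))
      _ = _ := by
          refine setLIntegral_congr_fun measurableSet_Ioc fun t ht => ?_
          rw [lintegral_indicator_one measurableSet_Ioc,
            negSecondDeriv_Ioc hI hχ hx (hsub (Ioc_subset_Icc_self ht))]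
  · rw [uIcc_of_ge hxy] at hsub
    have hnn : ∀ t ∈ Ioc y x, 0 ≤ negRightDeriv χ x - negRightDeriv χ t := fun t ht =>
      sub_nonneg.2 (hmono (hsub (Ioc_subset_Icc_self ht)) hx ht.2)
    have hae : 0 ≤ᵐ[volume.restrict (Ioc y x)] fun t => negRightDeriv χ x - negRightDeriv χ t :=
      (ae_restrict_mem measurableSet_Ioc).mono hnn
    rw [intervalIntegral.integral_symm, ← intervalIntegral.integral_neg,
      intervalIntegral.integral_of_le hxy] at hgap
    simp only [neg_sub] at hgap
    refine ⟨hgap ▸ integral_nonneg_of_ae hae, ?_⟩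
    rw [hgap, ofReal_integral_eq_lintegral_ofReal
      ((intervalIntegrable_const.sub hint.symm).1) hae]
    calc ∫⁻ z, ENNReal.ofReal (taylorKernel x y z) ∂negSecondDeriv I χ
        = ∫⁻ z, (∫⁻ t in Ioc y x, (Ioc t x).indicator 1 z) ∂negSecondDeriv I χ := by
          refine lintegral_congr fun z => ?_
          have : ∀ t, (Ioc t x).indicator (1 : ℝ → ℝ≥0∞) z =
              ({t | t < z ∧ z ≤ x}).indicator 1 t := fun t => by
            simp only [indicator_apply, mem_Ioc, mem_ofPred_eq, Pi.one_apply]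
          simp only [this]
          rw [lintegral_indicator_one (s := {t | t < z ∧ z ≤ x})
            (measurableSet_Iio.inter (MeasurableSet.const (z ≤ x))),
          Measure.restrict_apply' measurableSet_Ioc, taylorKernel]
          split_ifs with h
          · simp only [not_le.2 h, and_false]
            rw [max_eq_right (by linarith)]
            simp
          · rw [not_lt] at h
            have : {t | t < z ∧ z ≤ x} ∩ Ioc y x = Ioo y z := by
              ext t; simp only [mem_inter_iff, mem_ofPred_eq, mem_Ioc, mem_Ioo]
              constructor
              · rintro ⟨⟨h1, -⟩, h2, -⟩; exact ⟨h2, h1⟩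
              · rintro ⟨h1, h2⟩; exact ⟨⟨h2, h⟩, h1, (h2.trans_le h).le⟩
            rw [this, Real.volume_Ioo, ENNReal.ofReal_max]
            simp
      _ = ∫⁻ t in Ioc y x, (∫⁻ z, (Ioc t x).indicator 1 z ∂negSecondDeriv I χ) := by
          refine lintegral_lintegral_swap (Measurable.aemeasurable ?_)
          have : MeasurableSet {p : ℝ × ℝ | p.2 < p.1 ∧ p.1 ≤ x} :=
            (measurableSet_lt measurable_snd measurable_fst).inter
              (measurableSet_le measurable_fst measurable_const)
          exact (measurable_one.indicator this : Measurable
            ({p : ℝ × ℝ | p.2 < p.1 ∧ p.1 ≤ x}.indicator (1 : ℝ × ℝ → ℝ≥0∞)))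
      _ = _ := by
          refine setLIntegral_congr_fun measurableSet_Ioc fun t ht => ?_
          rw [lintegral_indicator_one measurableSet_Ioc,
            negSecondDeriv_Ioc hI hχ (hsub (Ioc_subset_Icc_self ht)) hx]

/-! ### Intervals with endpoints, and the jump term in Taylor's formula -/

/-- An open interval `I` with some of its endpoints added. -/
structure IsIntervalPair (I J : Set ℝ) : Prop where
  isOpen : IsOpen I
  ordConnected : I.OrdConnected
  subset : I ⊆ J
  subset_closure : J ⊆ closure I

namespace IsIntervalPair

variable {I J : Set ℝ} (h : IsIntervalPair I J)
include h

lemma bound_of_mem_diff {y : ℝ} (hy : y ∈ J \ I) : (∀ x ∈ I, x < y) ∨ ∀ x ∈ I, y < x := by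
  by_contra! H
  obtain ⟨⟨a, ha, hya⟩, b, hb, hyb⟩ := H
  exact hy.2 (h.ordConnected.out hb ha ⟨hyb, hya⟩)

/-- A point of `J` outside `I` bounds `I` and lies in its closure, so it is the supremum or the
infimum of `I`. -/
lemma finite_diff : (J \ I).Finite := by
  refine (Set.toFinite {sSup I, sInf I}).subset fun y hy => ?_
  have hne : I.Nonempty := closure_nonempty_iff.1 ⟨y, h.subset_closure hy.1⟩
  rcases h.bound_of_mem_diff hy with hb | hb
  · exact Or.inl ((isLUB_of_mem_closure (fun x hx => (hb x hx).le)
      (h.subset_closure hy.1)).csSup_eq hne).symm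
  · exact Or.inr ((isGLB_of_mem_closure (fun x hx => (hb x hx).le)
      (h.subset_closure hy.1)).csInf_eq hne).symm

lemma measurableSet : MeasurableSet J := by
  rw [← sdiff_union_of_subset h.subset]
  exact h.finite_diff.measurableSet.union h.isOpen.measurableSet

lemma mem_of_lt_of_lt {a b z : ℝ} (ha : a ∈ J) (hb : b ∈ J) (haz : a < z) (hzb : z < b) :
    z ∈ I := by
  obtain ⟨a', ha', haI⟩ := mem_closure_iff.1 (h.subset_closure ha) (Iio z) isOpen_Iio haz
  obtain ⟨b', hb', hbI⟩ := mem_closure_iff.1 (h.subset_closure hb) (Ioi z) isOpen_Ioi hzb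
  exact h.ordConnected.out haI hbI ⟨(mem_Iio.1 ha').le, (mem_Ioi.1 hb').le⟩

lemma eventually_between {x y : ℝ} (hx : x ∈ I) (hy : y ∈ J \ I) :
    ∀ᶠ y' in 𝓝[I] y, y' ∈ I ∧ y' ∈ openSegment ℝ x y := by
  rcases h.bound_of_mem_diff hy with hb | hb
  · filter_upwards [self_mem_nhdsWithin, mem_nhdsWithin_of_mem_nhds (Ioi_mem_nhds (hb x hx))]
      with y' h1 h2
    exact ⟨h1, by rw [openSegment_eq_Ioo (hb x hx)]; exact ⟨h2, hb y' h1⟩⟩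
  · filter_upwards [self_mem_nhdsWithin, mem_nhdsWithin_of_mem_nhds (Iio_mem_nhds (hb x hx))]
      with y' h1 h2
    exact ⟨h1, by
      rw [openSegment_symm, openSegment_eq_Ioo (hb x hx)]; exact ⟨hb y' h1, h2⟩⟩

end IsIntervalPair

/-- Taylor's remainder, written in terms of the second derivative measure and the jumps. -/
noncomputable def taylorRem (I J : Set ℝ) (χ : ℝ → ℝ) (x y : ℝ) : ℝ≥0∞ :=
  ∫⁻ z in I, ENNReal.ofReal (taylorKernel x y z) ∂negSecondDeriv I χ +
    (J \ I).indicator (fun b => ENNReal.ofReal (jump I χ b)) y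

/-- **Taylor's formula** for a concave function on an interval. -/
theorem taylorRem_eq {I J : Set ℝ} (h : IsIntervalPair I J) {χ : ℝ → ℝ} (hχ : ConcaveOn ℝ J χ)
    {x y : ℝ} (hx : x ∈ I) (hy : y ∈ J) :
    0 ≤ taylorGap χ x y ∧ taylorRem I J χ x y = ENNReal.ofReal (taylorGap χ x y) := by
  have hχI : ConcaveOn ℝ I χ := hχ.subset h.subset h.ordConnected.convex
  by_cases hyI : y ∈ I
  · obtain ⟨h1, h2⟩ := lintegral_taylorKernel h.isOpen hχI hx hyI
    refine ⟨h1, ?_⟩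
    rw [taylorRem, h2, indicator_of_notMem (fun hy' => hy'.2 hyI), add_zero]
  have hyd : y ∈ J \ I := ⟨hy, hyI⟩
  have hne : (𝓝[I] y).NeBot := mem_closure_iff_nhdsWithin_neBot.1 (h.subset_closure hy)
  have hev := h.eventually_between hx hyd
  -- The gap is convex in `y` and zero at `x`: at `y' = a x + b y` it is at most `b` times the gap
  -- at `y`. Since it is nonnegative at `y' ∈ I`, it is nonnegative at the endpoint as well.
  have hseg : ∀ y' ∈ I, y' ∈ openSegment ℝ x y →
      0 ≤ taylorGap χ x y ∧ taylorGap χ x y' ≤ taylorGap χ x y := by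
    rintro y' hy' ⟨a, b, ha, hb, hab, rfl⟩
    have h1 := (lintegral_taylorKernel h.isOpen hχI hx hy').1
    have h2 := hχ.2 (h.subset hx) hy ha.le hb.le hab
    have h3 : taylorGap χ x (a • x + b • y) ≤ b * taylorGap χ x y := by
      simp only [taylorGap, smul_eq_mul] at h2 ⊢
      obtain rfl : a = 1 - b := by linarith
      linarith
    have h4 : 0 ≤ taylorGap χ x y := by
      by_contra! hlt
      nlinarith
    exact ⟨h4, h3.trans (by nlinarith)⟩
  obtain ⟨y₀, hy₀I, hy₀⟩ := hev.exists
  have hnn : 0 ≤ taylorGap χ x y := (hseg y₀ hy₀I hy₀).1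
  refine ⟨hnn, ?_⟩
  let F : ℝ → ℝ≥0∞ := fun y' => ∫⁻ z in I, ENNReal.ofReal (taylorKernel x y' z) ∂negSecondDeriv I χ
  have hF : ∀ y' ∈ I, F y' = ENNReal.ofReal (taylorGap χ x y') := fun y' hy' =>
    (lintegral_taylorKernel h.isOpen hχI hx hy').2
  have hmeas : ∀ y', Measurable fun z => ENNReal.ofReal (taylorKernel x y' z) := fun y' =>
    (measurable_taylorKernel.comp (by fun_prop : Measurable fun z : ℝ => ((x, y'), z))).ennreal_ofReal
  have hptw : ∀ z, Tendsto (fun y' => ENNReal.ofReal (taylorKernel x y' z)) (𝓝[I] y)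
      (𝓝 (ENNReal.ofReal (taylorKernel x y z))) := fun z =>
    (ENNReal.continuous_ofReal.comp (continuous_taylorKernel_mid x z)).continuousAt.mono_left
      nhdsWithin_le_nhds
  obtain ⟨u, hu⟩ := (𝓝[I] y).exists_seq_tendsto
  -- Fatou gives finiteness first; only then can the kernel at `y` serve as a dominating function.
  have hFy : F y ≤ ENNReal.ofReal (taylorGap χ x y) := by
    calc F y = ∫⁻ z in I, liminf (fun n => ENNReal.ofReal (taylorKernel x (u n) z)) atTop
          ∂negSecondDeriv I χ := by
          refine lintegral_congr fun z => ?_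
          exact ((hptw z).comp hu).liminf_eq.symm
      _ ≤ liminf (fun n => F (u n)) atTop := lintegral_liminf_le fun n => hmeas _
      _ ≤ ENNReal.ofReal (taylorGap χ x y) := by
          refine liminf_le_of_frequently_le' (Eventually.frequently ?_)
          filter_upwards [hu.eventually hev] with n hn
          rw [hF _ hn.1]
          exact ENNReal.ofReal_le_ofReal (hseg _ hn.1 hn.2).2
  have hFtop : F y ≠ ⊤ := (hFy.trans_lt ENNReal.ofReal_lt_top).ne
  have hFt : Tendsto F (𝓝[I] y) (𝓝 (F y)) := by
    refine tendsto_lintegral_filter_of_dominated_convergence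
      (fun z => ENNReal.ofReal (taylorKernel x y z)) (Eventually.of_forall hmeas) ?_ hFtop
      (ae_of_all _ hptw)
    filter_upwards [hev] with y' hy'
    refine ae_of_all _ fun z => ENNReal.ofReal_le_ofReal (taylorKernel_le_of_mem_segment ?_ z)
    rw [← segment_eq_uIcc]
    exact openSegment_subset_segment _ _ _ hy'.2
  have hgt : Tendsto (taylorGap χ x) (𝓝[I] y) (𝓝 (F y).toReal) := by
    refine ((ENNReal.tendsto_toReal hFtop).comp hFt).congr' ?_
    filter_upwards [self_mem_nhdsWithin] with y' hy'
    rw [Function.comp, hF y' hy',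
      ENNReal.toReal_ofReal (lintegral_taylorKernel h.isOpen hχI hx hy').1]
  have hle : (F y).toReal ≤ taylorGap χ x y :=
    ENNReal.toReal_le_of_le_ofReal hnn hFy
  -- The limit of `χ` at the endpoint is now identified, and the jump is exactly what the integral
  -- misses of the gap.
  have hχt : Tendsto χ (𝓝[I] y) (𝓝 (χ x - (F y).toReal - negRightDeriv χ x * (y - x))) := by
    have ht : Tendsto (fun y' : ℝ => y') (𝓝[I] y) (𝓝 y) := tendsto_id.mono_left nhdsWithin_le_nhds
    refine ((tendsto_const_nhds (x := χ x)).sub hgt |>.sub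
      ((ht.sub_const x).const_mul (negRightDeriv χ x))).congr fun y' => ?_
    rw [taylorGap]
    ring
  have hjump : jump I χ y = taylorGap χ x y - (F y).toReal := by
    rw [jump, hχt.limUnder_eq, abs_of_nonneg]
    · rw [taylorGap]; ring
    · rw [taylorGap] at hle; linarith
  rw [taylorRem, indicator_of_mem hyd, hjump]
  change F y + _ = _
  nth_rw 1 [← ENNReal.ofReal_toReal hFtop]
  rw [← ENNReal.ofReal_add ENNReal.toReal_nonneg (by linarith), add_sub_cancel]

/-! ### The domain of an irreducible pair -/

lemma integrable_abs_sub {μ : Measure ℝ} [IsFiniteMeasure μ]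
    (hμ : Integrable (fun x : ℝ => x) μ) (x : ℝ) : Integrable (fun y => |x - y|) μ :=
  ((integrable_const x).sub hμ).abs

lemma continuous_potential {μ : Measure ℝ} [IsFiniteMeasure μ]
    (hμ : Integrable (fun x : ℝ => x) μ) : Continuous (potential μ) := by
  refine (LipschitzWith.of_dist_le' (K := μ.real univ) fun x x' => ?_).continuous
  rw [Real.dist_eq, Real.dist_eq, potential, potential,
    ← integral_sub (integrable_abs_sub hμ x) (integrable_abs_sub hμ x'), mul_comm, ← Real.norm_eq_abs]
  refine norm_integral_le_of_norm_le_const (ae_of_all _ fun y => ?_)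
  rw [Real.norm_eq_abs]
  have := abs_abs_sub_abs_le (x - y) (x' - y)
  rwa [sub_sub_sub_cancel_right] at this

/-- An affine function and its negative are both convex. -/
lemma ConvexOrder.integral_affine {μ ν : Measure ℝ} [IsFiniteMeasure ν] (hc : ConvexOrder μ ν)
    (hν : Integrable (fun x : ℝ => x) ν) (a b : ℝ) :
    ∫ x, (a * x + b) ∂μ = ∫ x, (a * x + b) ∂ν := by
  have hconv : ∀ a b : ℝ, ConvexOn ℝ univ fun x => a * x + b := fun a b => by
    refine ⟨convex_univ, fun x _ y _ s t _ _ hst => le_of_eq ?_⟩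
    simp only [smul_eq_mul]
    obtain rfl : s = 1 - t := by linarith
    ring
  have hi : ∀ a b : ℝ, Integrable (fun x => a * x + b) ν := fun a b =>
    (hν.const_mul a).add (integrable_const b)
  refine le_antisymm (hc _ (hconv a b) (hi a b)).2 ?_
  have := (hc _ (hconv (-a) (-b)) (hi (-a) (-b))).2
  have e : ∀ x : ℝ, -a * x + -b = -(a * x + b) := fun x => by ring
  simp only [e, integral_neg] at this
  linarith

section Pair

variable {μ ν : Measure ℝ} [IsFiniteMeasure μ] [IsFiniteMeasure ν]

namespace Irreducible

variable (hirr : Irreducible μ ν) (hμ : Integrable (fun x : ℝ => x) μ)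
  (hν : Integrable (fun x : ℝ => x) ν)
include hirr hμ hν

lemma isIntervalPair_of_subset {J : Set ℝ} (h1 : domI μ ν ⊆ J) (h2 : J ⊆ closure (domI μ ν)) :
    IsIntervalPair (domI μ ν) J where
  isOpen := isOpen_lt (continuous_potential hμ) (continuous_potential hν)
  ordConnected := hirr.connected.ordConnected
  subset := h1
  subset_closure := h2

lemma isIntervalPair : IsIntervalPair (domI μ ν) (domJ μ ν) :=
  hirr.isIntervalPair_of_subset hμ hν subset_union_left
    (union_subset subset_closure fun _ hb => frontier_subset_closure hb.1)

lemma ae_mem_domI : ∀ᵐ x ∂μ, x ∈ domI μ ν := by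
  have hm := (hirr.isIntervalPair hμ hν).isOpen.measurableSet
  rw [ae_iff]
  change μ (domI μ ν)ᶜ = 0
  rw [measure_compl hm (measure_ne_top _ _), hirr.concentrated, tsub_self]

/-- As `μ` lives to the left of `b`, `u_μ(b) = ∫ (b - y) dμ = ∫ (b - y) dν ≤ u_ν(b)`. Since `b ∉ I`,
equality holds, and so `|b - y| = b - y` for `ν`-almost every `y`. -/
lemma ae_le_of_forall_lt {b : ℝ} (hb : ∀ x ∈ domI μ ν, x < b) : ∀ᵐ y ∂ν, y ≤ b := by
  have hbI : ¬ potential μ b < potential ν b := fun h => lt_irrefl b (hb b h)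
  have e1 : potential μ b = ∫ y, (-1 * y + b) ∂μ := by
    refine integral_congr_ae ?_
    filter_upwards [hirr.ae_mem_domI hμ hν] with x hx
    rw [abs_of_pos (sub_pos.2 (hb x hx))]; ring
  rw [hirr.convexOrder.integral_affine hν] at e1
  have hi : Integrable (fun y => -1 * y + b) ν := (hν.const_mul _).add (integrable_const _)
  have hnn : ∀ y, 0 ≤ |b - y| - (-1 * y + b) := fun y => by
    have := le_abs_self (b - y); linarith
  have h0 : ∫ y, (|b - y| - (-1 * y + b)) ∂ν = 0 := by
    refine le_antisymm ?_ (integral_nonneg hnn)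
    rw [integral_sub (integrable_abs_sub hν b) hi, ← e1]
    change potential ν b - _ ≤ 0
    linarith
  rw [integral_eq_zero_iff_of_nonneg hnn ((integrable_abs_sub hν b).sub hi)] at h0
  filter_upwards [h0] with y hy
  have : |b - y| = b - y := by simp only [Pi.zero_apply] at hy; linarith
  linarith [abs_eq_self.1 this]

lemma ae_ge_of_forall_lt {b : ℝ} (hb : ∀ x ∈ domI μ ν, b < x) : ∀ᵐ y ∂ν, b ≤ y := by
  have hbI : ¬ potential μ b < potential ν b := fun h => lt_irrefl b (hb b h)
  have e1 : potential μ b = ∫ y, (1 * y + -b) ∂μ := by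
    refine integral_congr_ae ?_
    filter_upwards [hirr.ae_mem_domI hμ hν] with x hx
    rw [abs_of_neg (sub_neg.2 (hb x hx))]; ring
  rw [hirr.convexOrder.integral_affine hν] at e1
  have hi : Integrable (fun y => 1 * y + -b) ν := (hν.const_mul _).add (integrable_const _)
  have hnn : ∀ y, 0 ≤ |b - y| - (1 * y + -b) := fun y => by
    have := neg_le_abs (b - y); linarith
  have h0 : ∫ y, (|b - y| - (1 * y + -b)) ∂ν = 0 := by
    refine le_antisymm ?_ (integral_nonneg hnn)
    rw [integral_sub (integrable_abs_sub hν b) hi, ← e1]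
    change potential ν b - _ ≤ 0
    linarith
  rw [integral_eq_zero_iff_of_nonneg hnn ((integrable_abs_sub hν b).sub hi)] at h0
  filter_upwards [h0] with y hy
  have : |b - y| = -(b - y) := by simp only [Pi.zero_apply] at hy; linarith
  linarith [abs_eq_neg_self.1 this]

/-- `ν` lives on the closure of `I` by the two preceding lemmas, and the at most two endpoints that
are not atoms form a null set. -/
lemma ae_mem_domJ : ∀ᵐ y ∂ν, y ∈ domJ μ ν := by
  have hcl := hirr.isIntervalPair_of_subset hμ hν subset_closure subset_rfl
  have h1 : ∀ᵐ y ∂ν, BddAbove (domI μ ν) → y ≤ sSup (domI μ ν) := by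
    by_cases hb : BddAbove (domI μ ν)
    · refine (hirr.ae_le_of_forall_lt hμ hν (b := sSup (domI μ ν)) fun x hx => ?_).mono
        fun y hy _ => hy
      refine lt_of_le_of_ne (le_csSup hb hx) fun h => ?_
      obtain ⟨x', hx', hxI⟩ : ∃ x' ∈ domI μ ν, x < x' := by
        have hmem : domI μ ν ∈ 𝓝[>] x := mem_nhdsWithin_of_mem_nhds (hcl.isOpen.mem_nhds hx)
        exact ((eventually_mem_set.2 hmem).and self_mem_nhdsWithin).exists
      exact absurd (le_csSup hb hx') (not_le.2 (h ▸ hxI))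
    · exact ae_of_all _ fun y h => absurd h hb
  have h2 : ∀ᵐ y ∂ν, BddBelow (domI μ ν) → sInf (domI μ ν) ≤ y := by
    by_cases hb : BddBelow (domI μ ν)
    · refine (hirr.ae_ge_of_forall_lt hμ hν (b := sInf (domI μ ν)) fun x hx => ?_).mono
        fun y hy _ => hy
      refine lt_of_le_of_ne (csInf_le hb hx) fun h => ?_
      obtain ⟨x', hx', hxI⟩ : ∃ x' ∈ domI μ ν, x' < x := by
        have hmem : domI μ ν ∈ 𝓝[<] x := mem_nhdsWithin_of_mem_nhds (hcl.isOpen.mem_nhds hx)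
        exact ((eventually_mem_set.2 hmem).and self_mem_nhdsWithin).exists
      exact absurd (csInf_le hb hx') (not_le.2 (h ▸ hxI))
    · exact ae_of_all _ fun y h => absurd h hb
  -- If `I` is empty, then `μ = 0` as `μ` is concentrated on `I`, and equality of total masses gives
  -- `ν = 0`.
  have h3 : ∀ᵐ y ∂ν, (domI μ ν).Nonempty := by
    by_cases hne : (domI μ ν).Nonempty
    · exact ae_of_all _ fun _ => hne
    · rw [not_nonempty_iff_eq_empty] at hne
      have h4 := hirr.concentrated
      rw [hne, measure_empty] at h4
      have h5 := hirr.convexOrder.integral_affine hν 0 1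
      rw [Measure.measure_univ_eq_zero.1 h4.symm] at h5
      simp only [zero_mul, zero_add, integral_const, smul_eq_mul, mul_one] at h5
      rw [eq_comm, measureReal_zero_apply, measureReal_eq_zero_iff,
        Measure.measure_univ_eq_zero] at h5
      simp [h5]
  have h4 : ∀ᵐ y ∂ν, y ∉ {y | y ∈ closure (domI μ ν) \ domI μ ν ∧ ν {y} = 0} := by
    rw [← measure_eq_zero_iff_ae_notMem, ← biUnion_of_singleton {y | y ∈ closure (domI μ ν) \
      domI μ ν ∧ ν {y} = 0}, measure_biUnion_null_iff]
    · exact fun y hy => hy.2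
    · exact (hcl.finite_diff.subset fun y hy => hy.1).countable
  filter_upwards [h1, h2, h3, h4] with y k1 k2 k3 k4
  by_cases hy : y ∈ domI μ ν
  · exact Or.inl hy
  have hycl : y ∈ closure (domI μ ν) := by
    by_cases hlt : ∃ a ∈ domI μ ν, y < a
    · obtain ⟨a, ha, hya⟩ := hlt
      have hlb : y ∈ lowerBounds (domI μ ν) := fun x hx => by
        by_contra! hlt'
        exact hy (hcl.ordConnected.out hx ha ⟨hlt'.le, hya.le⟩)
      rw [le_antisymm (le_csInf k3 hlb) (k2 ⟨y, hlb⟩)]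
      exact csInf_mem_closure k3 ⟨y, hlb⟩
    · push Not at hlt
      rw [le_antisymm (k1 ⟨y, hlt⟩) (csSup_le k3 hlt)]
      exact csSup_mem_closure k3 ⟨y, hlt⟩
  refine Or.inr ⟨?_, ?_⟩
  · rw [hcl.isOpen.frontier_eq]
    exact ⟨hycl, hy⟩
  · exact pos_iff_ne_zero.2 fun h0 => k4 ⟨⟨hycl, hy⟩, h0⟩

/-- Otherwise `u_ν(x) = ∫ (y - x) dν = ∫ (y - x) dμ ≤ u_μ(x)`, which contradicts `x ∈ I`. -/
lemma measure_Iio_pos {x : ℝ} (hx : x ∈ domI μ ν) : 0 < ν (Iio x) := by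
  refine pos_iff_ne_zero.2 fun h0 => ?_
  have e : potential ν x = ∫ y, (1 * y + -x) ∂ν := by
    refine integral_congr_ae ?_
    filter_upwards [measure_eq_zero_iff_ae_notMem.1 h0] with y hy
    rw [abs_of_nonpos (by simp only [mem_Iio, not_lt] at hy; linarith)]
    ring
  rw [← hirr.convexOrder.integral_affine hν] at e
  have : ∫ y, (1 * y + -x) ∂μ ≤ potential μ x :=
    integral_mono ((hμ.const_mul _).add (integrable_const _)) (integrable_abs_sub hμ x) fun y => by
      have := neg_le_abs (x - y)
      simp only
      linarith
  have hx' : potential μ x < potential ν x := hx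
  linarith

lemma measure_Ioi_pos {x : ℝ} (hx : x ∈ domI μ ν) : 0 < ν (Ioi x) := by
  refine pos_iff_ne_zero.2 fun h0 => ?_
  have e : potential ν x = ∫ y, (-1 * y + x) ∂ν := by
    refine integral_congr_ae ?_
    filter_upwards [measure_eq_zero_iff_ae_notMem.1 h0] with y hy
    rw [abs_of_nonneg (by simp only [mem_Ioi, not_lt] at hy; linarith)]
    ring
  rw [← hirr.convexOrder.integral_affine hν] at e
  have : ∫ y, (-1 * y + x) ∂μ ≤ potential μ x :=
    integral_mono ((hμ.const_mul _).add (integrable_const _)) (integrable_abs_sub hμ x) fun y => by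
      have := le_abs_self (x - y)
      simp only
      linarith
  have hx' : potential μ x < potential ν x := hx
  linarith

end Irreducible

end Pair

/-! ### The concave integral in terms of a martingale kernel -/

lemma IsIntervalPair.measurable_indicator {I J : Set ℝ} (h : IsIntervalPair I J) {β : Type*}
    [MeasurableSpace β] [Zero β] (f : ℝ → β) : Measurable ((J \ I).indicator f) := by
  refine measurable_of_measurable_on_compl_finite (J \ I) h.finite_diff ?_
  have : (J \ I)ᶜ.domRestrict ((J \ I).indicator f) = fun _ => 0 := by
    ext x
    exact indicator_of_notMem x.2 f
  rw [this]
  exact measurable_const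

lemma IsIntervalPair.measurable_concave {I J : Set ℝ} (h : IsIntervalPair I J) {χ : ℝ → ℝ}
    (hχ : ConcaveOn ℝ J χ) : Measurable (J.indicator χ) := by
  have h1 : J.indicator χ = I.indicator χ + (J \ I).indicator χ := by
    ext x
    by_cases h1 : x ∈ I
    · simp [h1, h.subset h1]
    · by_cases h2 : x ∈ J <;> simp [h1, h2]
  rw [h1]
  refine Measurable.add ?_ (h.measurable_indicator χ)
  have hc : ContinuousOn χ I :=
    (hχ.subset h.subset h.ordConnected.convex).continuousOn h.isOpen
  classical
  rw [← piecewise_eq_indicator]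
  exact hc.measurable_piecewise continuousOn_const h.isOpen.measurableSet

lemma IsIntervalPair.aestronglyMeasurable_concave {I J : Set ℝ} (h : IsIntervalPair I J)
    {χ : ℝ → ℝ} (hχ : ConcaveOn ℝ J χ) {ρ : Measure ℝ} (hρ : ∀ᵐ y ∂ρ, y ∈ J) :
    AEStronglyMeasurable χ ρ := by
  refine ((h.measurable_concave hχ).aestronglyMeasurable (μ := ρ)).congr ?_
  filter_upwards [hρ] with y hy using indicator_of_mem hy χ

lemma IsIntervalPair.measurable_taylorRem {I J : Set ℝ} (h : IsIntervalPair I J) (χ : ℝ → ℝ) :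
    Measurable fun p : ℝ × ℝ => taylorRem I J χ p.1 p.2 := by
  unfold taylorRem
  refine Measurable.add ?_ ((h.measurable_indicator _).comp measurable_snd)
  exact Measurable.lintegral_prod_right'
    (f := fun q : (ℝ × ℝ) × ℝ => ENNReal.ofReal (taylorKernel q.1.1 q.1.2 q.2))
    measurable_taylorKernel.ennreal_ofReal

/-! ### Jensen gaps for measures with a given barycenter -/

/-- `ρ` is a probability measure on `J` with barycenter `x ∈ I`. -/
structure IsSpread (I J : Set ℝ) (x : ℝ) (ρ : Measure ℝ) : Prop where
  mem : x ∈ I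
  isProbabilityMeasure : IsProbabilityMeasure ρ
  ae_mem : ∀ᵐ y ∂ρ, y ∈ J
  integrable : Integrable (fun y : ℝ => y) ρ
  mean : ∫ y, y ∂ρ = x

namespace IsSpread

variable {I J : Set ℝ} (h : IsIntervalPair I J) {x : ℝ} {ρ : Measure ℝ} (hs : IsSpread I J x ρ)
  {χ : ℝ → ℝ} (hχ : ConcaveOn ℝ J χ)
include h hs hχ

lemma lintegral_taylorRem_eq_lintegral_taylorGap :
    ∫⁻ y, taylorRem I J χ x y ∂ρ = ∫⁻ y, ENNReal.ofReal (taylorGap χ x y) ∂ρ := by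
  refine lintegral_congr_ae ?_
  filter_upwards [hs.ae_mem] with y hy using (taylorRem_eq h hχ hs.mem hy).2

/-- The linear term of the Taylor gap integrates to zero because the barycenter is `x`; what remains
is the Jensen gap. -/
lemma lintegral_taylorRem_eq (hi : Integrable χ ρ) :
    0 ≤ χ x - ∫ y, χ y ∂ρ ∧
      ∫⁻ y, taylorRem I J χ x y ∂ρ = ENNReal.ofReal (χ x - ∫ y, χ y ∂ρ) := by
  have := hs.isProbabilityMeasure
  have i1 : Integrable (fun y => χ x - χ y) ρ := (integrable_const _).sub hi
  have i2 : Integrable (fun y => negRightDeriv χ x * (y - x)) ρ :=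
    (hs.integrable.sub (integrable_const _)).const_mul _
  have hnn : 0 ≤ᵐ[ρ] fun y => taylorGap χ x y := by
    filter_upwards [hs.ae_mem] with y hy using (taylorRem_eq h hχ hs.mem hy).1
  have hgap : ∫ y, taylorGap χ x y ∂ρ = χ x - ∫ y, χ y ∂ρ := by
    unfold taylorGap
    rw [integral_sub i1 i2, integral_sub (integrable_const _) hi, integral_const_mul,
      integral_sub hs.integrable (integrable_const _), hs.mean]
    simp
  refine ⟨hgap ▸ integral_nonneg_of_ae hnn, ?_⟩
  rw [hs.lintegral_taylorRem_eq_lintegral_taylorGap h hχ, ← hgap,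
    ofReal_integral_eq_lintegral_ofReal (f := taylorGap χ x) (i1.sub i2) hnn]

/-- `χ` is an affine function minus its Taylor gap. Consequently the integrated remainder is
infinite for nonintegrable `χ`, and identities between remainders persist in that case. -/
lemma integrable_of_lintegral_taylorRem (hlt : ∫⁻ y, taylorRem I J χ x y ∂ρ < ⊤) :
    Integrable χ ρ := by
  have := hs.isProbabilityMeasure
  rw [hs.lintegral_taylorRem_eq_lintegral_taylorGap h hχ] at hlt
  have hm := h.aestronglyMeasurable_concave hχ hs.ae_mem
  have i2 : Integrable (fun y => negRightDeriv χ x * (y - x)) ρ :=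
    (hs.integrable.sub (integrable_const _)).const_mul _
  have i3 : Integrable (taylorGap χ x) ρ := by
    refine ⟨(aestronglyMeasurable_const.sub hm).sub i2.aestronglyMeasurable, ?_⟩
    rw [hasFiniteIntegral_iff_ofReal]
    · exact hlt
    · filter_upwards [hs.ae_mem] with y hy using (taylorRem_eq h hχ hs.mem hy).1
  refine ((integrable_const (χ x)).sub (i3.add i2)).congr (ae_of_all _ fun y => ?_)
  simp only [Pi.sub_apply, Pi.add_apply, taylorGap]
  ring

end IsSpread

section Kernel

variable {μ ν : Measure ℝ} [IsFiniteMeasure μ] [IsFiniteMeasure ν] {κ : Kernel ℝ ℝ}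

lemma IsMartingaleKernel.ae_isSpread (hκ : IsMartingaleKernel μ ν κ)
    (hirr : Irreducible μ ν) (hμ : Integrable (fun x : ℝ => x) μ)
    (hν : Integrable (fun x : ℝ => x) ν) :
    ∀ᵐ x ∂μ, IsSpread (domI μ ν) (domJ μ ν) x (κ x) := by
  have := hκ.markov
  have h1 : ∀ᵐ p ∂(μ ⊗ₘ κ), p.2 ∈ domJ μ ν := by
    refine ae_of_ae_map (p := fun y => y ∈ domJ μ ν) measurable_snd.aemeasurable ?_
    change ∀ᵐ y ∂(μ ⊗ₘ κ).snd, y ∈ domJ μ ν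
    rw [hκ.snd_eq]
    exact hirr.ae_mem_domJ hμ hν
  filter_upwards [hirr.ae_mem_domI hμ hν, Measure.ae_ae_of_ae_compProd h1, hκ.integrable, hκ.mean]
    with x k1 k2 k3 k4
  exact ⟨k1, inferInstance, k2, k3, k4⟩

omit [IsFiniteMeasure ν] in
lemma IsMartingaleKernel.lintegral_snd (hκ : IsMartingaleKernel μ ν κ) {f : ℝ → ℝ≥0∞}
    (hf : Measurable f) : ∫⁻ x, ∫⁻ y, f y ∂κ x ∂μ = ∫⁻ y, f y ∂ν := by
  have := hκ.markov
  rw [← Measure.lintegral_compProd (f := fun p => f p.2) (hf.comp measurable_snd), ← hκ.snd_eq,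
    Measure.snd, lintegral_map hf measurable_snd]

-- The martingale property removes the sign term of `taylorKernel_eq`; the marginals turn the other
-- two into potentials.
omit [IsFiniteMeasure ν] in
lemma IsMartingaleKernel.lintegral_taylorKernel (hκ : IsMartingaleKernel μ ν κ)
    (hμ : Integrable (fun x : ℝ => x) μ) (hν : Integrable (fun x : ℝ => x) ν) (z : ℝ) :
    ∫⁻ p, ENNReal.ofReal (taylorKernel p.1 p.2 z) ∂(μ ⊗ₘ κ) =
      ENNReal.ofReal ((potential ν z - potential μ z) / 2) := by
  have := hκ.markov
  have hfst : (μ ⊗ₘ κ).fst = μ := Measure.fst_compProd μ κ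
  have j1 : Integrable (fun p : ℝ × ℝ => p.1) (μ ⊗ₘ κ) := by
    have h := hμ
    rw [← hfst, Measure.fst] at h
    exact h.comp_measurable measurable_fst
  have j2 : Integrable (fun p : ℝ × ℝ => p.2) (μ ⊗ₘ κ) := by
    have h := hν
    rw [← hκ.snd_eq, Measure.snd] at h
    exact h.comp_measurable measurable_snd
  have i1 : Integrable (fun p : ℝ × ℝ => |z - p.1|) (μ ⊗ₘ κ) := ((integrable_const z).sub j1).abs
  have i2 : Integrable (fun p : ℝ × ℝ => |z - p.2|) (μ ⊗ₘ κ) := ((integrable_const z).sub j2).abs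
  have e1 : ∫ p, |z - p.1| ∂(μ ⊗ₘ κ) = potential μ z := by
    have := integral_map (μ := μ ⊗ₘ κ) measurable_fst.aemeasurable (f := fun x : ℝ => |z - x|)
      (by fun_prop)
    rw [← this]
    change ∫ y, |z - y| ∂(μ ⊗ₘ κ).fst = _
    rw [hfst, potential]
  have e2 : ∫ p, |z - p.2| ∂(μ ⊗ₘ κ) = potential ν z := by
    have := integral_map (μ := μ ⊗ₘ κ) measurable_snd.aemeasurable (f := fun x : ℝ => |z - x|)
      (by fun_prop)
    rw [← this]
    change ∫ y, |z - y| ∂(μ ⊗ₘ κ).snd = _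
    rw [hκ.snd_eq, potential]
  have hmσ : Measurable fun p : ℝ × ℝ => (if p.1 < z then (1 : ℝ) else -1) :=
    Measurable.ite (measurableSet_lt measurable_fst measurable_const) measurable_const
      measurable_const
  have i3 : Integrable (fun p : ℝ × ℝ => (if p.1 < z then (1 : ℝ) else -1) * (p.2 - p.1))
      (μ ⊗ₘ κ) := (j2.sub j1).bdd_mul (c := 1) hmσ.aestronglyMeasurable
        (ae_of_all _ fun p => by split_ifs <;> simp)
  have e3 : ∫ p, (if p.1 < z then (1 : ℝ) else -1) * (p.2 - p.1) ∂(μ ⊗ₘ κ) = 0 := by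
    rw [Measure.integral_compProd i3]
    refine integral_eq_zero_of_ae ?_
    filter_upwards [hκ.integrable, hκ.mean] with x k1 k2
    change ∫ y, (if x < z then (1 : ℝ) else -1) * (y - x) ∂κ x = 0
    rw [integral_const_mul, integral_sub k1 (integrable_const _), k2]
    simp
  have i12 : Integrable (fun p : ℝ × ℝ => |z - p.2| - |z - p.1|) (μ ⊗ₘ κ) := i2.sub i1
  have i4 : Integrable (fun p : ℝ × ℝ => taylorKernel p.1 p.2 z) (μ ⊗ₘ κ) := by
    simp only [taylorKernel_eq]
    exact (i12.add i3).div_const 2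
  rw [← ofReal_integral_eq_lintegral_ofReal i4 (ae_of_all _ fun p => taylorKernel_nonneg _ _ _)]
  simp only [taylorKernel_eq]
  rw [integral_div, integral_add i12 i3, integral_sub i2 i1, e1, e2, e3, add_zero]

/-- The concave integral is the integral of Taylor's remainder with respect to any martingale
coupling. -/
theorem IsMartingaleKernel.concaveIntegral_eq (hκ : IsMartingaleKernel μ ν κ)
    (hirr : Irreducible μ ν) (hμ : Integrable (fun x : ℝ => x) μ)
    (hν : Integrable (fun x : ℝ => x) ν) (χ : ℝ → ℝ) :
    concaveIntegral μ ν χ =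
      ∫⁻ x, ∫⁻ y, taylorRem (domI μ ν) (domJ μ ν) χ x y ∂κ x ∂μ := by
  have := hκ.markov
  have hp := hirr.isIntervalPair hμ hν
  have hmj := hp.measurable_indicator (fun b => ENNReal.ofReal (jump (domI μ ν) χ b))
  rw [← Measure.lintegral_compProd (hp.measurable_taylorRem χ)]
  have hmj' : Measurable fun p : ℝ × ℝ => (domJ μ ν \ domI μ ν).indicator
      (fun b => ENNReal.ofReal (jump (domI μ ν) χ b)) p.2 := hmj.comp measurable_snd
  unfold taylorRem
  rw [lintegral_add_right _ hmj', concaveIntegral]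
  congr 1
  -- By Tonelli the kernel is integrated over the coupling first, which leaves `(u_ν - u_μ)/2` under
  -- `-χ''`.
  · rw [lintegral_lintegral_swap measurable_taylorKernel.ennreal_ofReal.aemeasurable]
    simp only [hκ.lintegral_taylorKernel hμ hν]
    rw [← lintegral_const_mul' _ _ (by simp)]
    refine lintegral_congr fun z => ?_
    rw [div_eq_inv_mul, ENNReal.ofReal_mul (by positivity), ENNReal.ofReal_inv_of_pos two_pos]
    simp
  -- The jump term depends on `y` only, so just the second marginal matters.
  · rw [← lintegral_indicator (hp.measurableSet.diff hp.isOpen.measurableSet),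
      ← hκ.lintegral_snd hmj, ← Measure.lintegral_compProd hmj']

end Kernel

/-! ### Calculus of the concave integral -/

lemma liminf_add_le_of_tendsto {u v : ℕ → ℝ≥0∞} {b : ℝ≥0∞}
    (hv : Tendsto v atTop (𝓝 b)) :
    liminf (fun n => u n + v n) atTop ≤ liminf u atTop + b := by
  obtain ⟨k, hk, hk'⟩ := exists_seq_tendsto_liminf (f := atTop) (u := u)
  have ht : Tendsto ((fun n => u n + v n) ∘ k) atTop (𝓝 (liminf u atTop + b)) :=
    hk.add (hv.comp hk')
  rw [← ht.liminf_eq]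
  exact hk'.liminf_le_liminf_comp

/-- Moves a real identity to `ℝ≥0∞`, with each negative part transferred to the other side, so that
no subtraction occurs. -/
lemma ofReal_balance {a₁ a₂ p n t : ℝ} (ha₁ : 0 ≤ a₁) (ha₂ : 0 ≤ a₂) (hp : 0 ≤ p) (hn : 0 ≤ n)
    (h : a₁ + p = a₂ + n + t) :
    ENNReal.ofReal a₁ + ENNReal.ofReal p + ENNReal.ofReal (-t) =
      ENNReal.ofReal a₂ + ENNReal.ofReal n + ENNReal.ofReal t := by
  rw [← ENNReal.ofReal_add ha₁ hp, ← ENNReal.ofReal_add ha₂ hn, h]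
  rcases le_total 0 t with ht | ht
  · rw [ENNReal.ofReal_of_nonpos (show -t ≤ 0 by linarith), add_zero,
      ENNReal.ofReal_add (by linarith) ht]
  · rw [ENNReal.ofReal_of_nonpos ht, add_zero, ← ENNReal.ofReal_add (by linarith) (by linarith)]
    congr 1
    ring

lemma integrable_of_lintegral_pos_neg {ρ : Measure ℝ} {G : ℝ → ℝ} (hm : AEStronglyMeasurable G ρ)
    (hp : ∫⁻ y, ENNReal.ofReal (G y) ∂ρ < ⊤) (hn : ∫⁻ y, ENNReal.ofReal (-G y) ∂ρ < ⊤) :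
    Integrable G ρ := by
  refine ⟨hm, ?_⟩
  rw [hasFiniteIntegral_iff_norm]
  refine lt_of_le_of_lt (lintegral_mono fun y => ?_)
    ((lintegral_add_left' hm.aemeasurable.ennreal_ofReal _).trans_lt (ENNReal.add_lt_top.2 ⟨hp, hn⟩))
  rw [Real.norm_eq_abs, abs_eq_max_neg, ENNReal.ofReal_max]
  exact max_le le_self_add le_add_self

namespace IsSpread

variable {I J : Set ℝ} (h : IsIntervalPair I J) {x : ℝ} {ρ : Measure ℝ} (hs : IsSpread I J x ρ)
include h hs

/-- `χ₁` lies below its tangent at `x` and above `χ₂ - G⁻`, and both bounds are `ρ`-integrable. -/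
lemma integrable_of_lintegral_neg {χ₁ χ₂ G : ℝ → ℝ} (hχ₁ : ConcaveOn ℝ J χ₁)
    (hG : ∀ y ∈ J, G y = χ₁ y - χ₂ y) (hGm : Measurable G)
    (hi : Integrable χ₂ ρ) (hn : ∫⁻ y, ENNReal.ofReal (-G y) ∂ρ < ⊤) : Integrable χ₁ ρ := by
  have := hs.isProbabilityMeasure
  have i1 : Integrable (fun y => χ₁ x - negRightDeriv χ₁ x * (y - x)) ρ :=
    (integrable_const _).sub ((hs.integrable.sub (integrable_const _)).const_mul _)
  have i2 : Integrable (fun y => (ENNReal.ofReal (-G y)).toReal) ρ :=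
    integrable_toReal_of_lintegral_ne_top hGm.neg.ennreal_ofReal.aemeasurable hn.ne
  refine MeasureTheory.Integrable.mono' ((i1.abs.add hi.abs).add i2)
    (h.aestronglyMeasurable_concave hχ₁ hs.ae_mem) ?_
  filter_upwards [hs.ae_mem] with y hy
  have h1 := (taylorRem_eq h hχ₁ hs.mem hy).1
  have h2 := hG y hy
  have h3 : -G y ≤ (ENNReal.ofReal (-G y)).toReal := by
    rw [ENNReal.toReal_ofReal']; exact le_max_left _ _
  have h4 : 0 ≤ (ENNReal.ofReal (-G y)).toReal := ENNReal.toReal_nonneg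
  rw [taylorGap] at h1
  simp only [Pi.add_apply]
  rw [Real.norm_eq_abs, abs_le]
  have h5 := le_abs_self (χ₁ x - negRightDeriv χ₁ x * (y - x))
  have h6 := abs_nonneg (χ₁ x - negRightDeriv χ₁ x * (y - x))
  have h7 := neg_abs_le (χ₂ y)
  have h8 := abs_nonneg (χ₂ y)
  constructor <;> linarith

/-- The difference of two Jensen gaps is `G(x) - ∫ G dρ`. Without subtractions, the identity can be
integrated over `x` before the terms on the left are known to have finite integrals. -/
lemma lintegral_taylorRem_balance {χ₁ χ₂ G : ℝ → ℝ} (hχ₁ : ConcaveOn ℝ J χ₁)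
    (hχ₂ : ConcaveOn ℝ J χ₂) (hG : ∀ y ∈ J, G y = χ₁ y - χ₂ y) (hGm : Measurable G)
    (h2 : ∫⁻ y, taylorRem I J χ₂ x y ∂ρ < ⊤) (hn : ∫⁻ y, ENNReal.ofReal (-G y) ∂ρ < ⊤) :
    ∫⁻ y, taylorRem I J χ₁ x y ∂ρ + ∫⁻ y, ENNReal.ofReal (G y) ∂ρ + ENNReal.ofReal (-G x) =
      ∫⁻ y, taylorRem I J χ₂ x y ∂ρ + ∫⁻ y, ENNReal.ofReal (-G y) ∂ρ + ENNReal.ofReal (G x) := by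
  have i2 := hs.integrable_of_lintegral_taylorRem h hχ₂ h2
  have i1 := hs.integrable_of_lintegral_neg h hχ₁ hG hGm i2 hn
  obtain ⟨n1, e1⟩ := hs.lintegral_taylorRem_eq h hχ₁ i1
  obtain ⟨n2, e2⟩ := hs.lintegral_taylorRem_eq h hχ₂ i2
  have hae : G =ᵐ[ρ] fun y => χ₁ y - χ₂ y := by filter_upwards [hs.ae_mem] with y hy using hG y hy
  have iG : Integrable G ρ := (i1.sub i2).congr hae.symm
  have hpos : ∫⁻ y, ENNReal.ofReal (G y) ∂ρ ≠ ⊤ := by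
    refine ((lintegral_mono fun y => ?_).trans_lt iG.hasFiniteIntegral).ne
    exact Real.ofReal_le_enorm _
  have hint := integral_eq_lintegral_pos_part_sub_lintegral_neg_part iG
  rw [integral_congr_ae hae, integral_sub i1 i2] at hint
  rw [e1, e2, ← ENNReal.ofReal_toReal hpos, ← ENNReal.ofReal_toReal hn.ne]
  refine ofReal_balance n1 n2 ENNReal.toReal_nonneg ENNReal.toReal_nonneg ?_
  rw [hG x (h.subset hs.mem)]
  linarith

/-- Expresses the remainder through integrals of the nonnegative function `-χ`, to which Fatou's
lemma applies; both sides may be infinite. -/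
lemma lintegral_taylorRem_add_ofReal {χ : ℝ → ℝ} (hχ : ConcaveOn ℝ J χ)
    (hneg : ∀ y ∈ J, χ y ≤ 0) :
    ∫⁻ y, taylorRem I J χ x y ∂ρ + ENNReal.ofReal (-χ x) = ∫⁻ y, ENNReal.ofReal (-χ y) ∂ρ := by
  have hae : 0 ≤ᵐ[ρ] fun y => -χ y := by
    filter_upwards [hs.ae_mem] with y hy using neg_nonneg.2 (hneg y hy)
  by_cases hi : Integrable χ ρ
  · obtain ⟨n1, e1⟩ := hs.lintegral_taylorRem_eq h hχ hi
    rw [e1, ← ENNReal.ofReal_add n1 (neg_nonneg.2 (hneg x (h.subset hs.mem))),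
      ← ofReal_integral_eq_lintegral_ofReal (f := fun y => -χ y) hi.neg hae, integral_neg]
    congr 1
    ring
  · have h1 : ∫⁻ y, taylorRem I J χ x y ∂ρ = ⊤ := by
      by_contra hne
      exact hi (hs.integrable_of_lintegral_taylorRem h hχ (lt_top_iff_ne_top.2 hne))
    have h2 : ∫⁻ y, ENNReal.ofReal (-χ y) ∂ρ = ⊤ := by
      by_contra hne
      refine hi (integrable_neg_iff.1 ⟨(h.aestronglyMeasurable_concave hχ hs.ae_mem).neg, ?_⟩)
      refine (hasFiniteIntegral_iff_ofReal (f := fun y => -χ y) hae).2 ?_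
      exact lt_top_iff_ne_top.2 hne
    rw [h1, h2, top_add]

lemma lintegral_taylorRem_add_affine {χ : ℝ → ℝ} (hχ : ConcaveOn ℝ J χ) (a b : ℝ)
    (hχ' : ConcaveOn ℝ J fun y => χ y + (a * y + b)) :
    ∫⁻ y, taylorRem I J (fun y => χ y + (a * y + b)) x y ∂ρ = ∫⁻ y, taylorRem I J χ x y ∂ρ := by
  have := hs.isProbabilityMeasure
  have ia : Integrable (fun y => a * y + b) ρ :=
    (hs.integrable.const_mul a).add (integrable_const b)
  by_cases hi : Integrable χ ρ
  · rw [(hs.lintegral_taylorRem_eq h hχ hi).2, (hs.lintegral_taylorRem_eq h hχ' (hi.add ia)).2,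
      integral_add hi ia, integral_add (hs.integrable.const_mul a) (integrable_const b),
      integral_const_mul, hs.mean]
    simp
  · have hi' : ¬ Integrable (fun y => χ y + (a * y + b)) ρ := fun hc =>
      hi ((hc.sub ia).congr (ae_of_all _ fun y => by simp))
    rw [not_lt_top_iff.1 (fun hlt => hi (hs.integrable_of_lintegral_taylorRem h hχ hlt)),
      not_lt_top_iff.1 (fun hlt => hi' (hs.integrable_of_lintegral_taylorRem h hχ' hlt))]

end IsSpread

namespace Irreducible

variable {μ ν : Measure ℝ} [IsFiniteMeasure μ] [IsFiniteMeasure ν] (hirr : Irreducible μ ν)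
  (hμ : Integrable (fun x : ℝ => x) μ) (hν : Integrable (fun x : ℝ => x) ν)
include hirr hμ hν

/-- Changing the moderator: if `χ₁ - χ₂` is integrable with respect to `μ` and its negative part is
integrable with respect to `ν`, then it is integrable with respect to `ν`, and the concave integrals
differ by the difference of its integrals. -/
theorem concaveIntegral_change {χ₁ χ₂ : ℝ → ℝ} (hχ₁ : ConcaveOn ℝ (domJ μ ν) χ₁)
    (hχ₂ : ConcaveOn ℝ (domJ μ ν) χ₂) (hi : Integrable (fun x => χ₁ x - χ₂ x) μ)
    (hn : ∫⁻ y, ENNReal.ofReal (χ₂ y - χ₁ y) ∂ν < ⊤) (hfin : concaveIntegral μ ν χ₂ < ⊤) :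
    concaveIntegral μ ν χ₁ < ⊤ ∧ Integrable (fun y => χ₁ y - χ₂ y) ν ∧
      (concaveIntegral μ ν χ₁).toReal + ∫ y, (χ₁ y - χ₂ y) ∂ν =
        (concaveIntegral μ ν χ₂).toReal + ∫ x, (χ₁ x - χ₂ x) ∂μ := by
  obtain ⟨κ, hκ⟩ := exists_isMartingaleKernel hμ hν hirr.convexOrder
  have := hκ.markov
  have h := hirr.isIntervalPair hμ hν
  -- Only the values on `J` are constrained; the indicators make the difference Borel on the whole
  -- line.
  let G : ℝ → ℝ := fun y => (domJ μ ν).indicator χ₁ y - (domJ μ ν).indicator χ₂ y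
  have hG : ∀ y ∈ domJ μ ν, G y = χ₁ y - χ₂ y := fun y hy => by
    simp only [G, indicator_of_mem hy]
  have hGm : Measurable G := (h.measurable_concave hχ₁).sub (h.measurable_concave hχ₂)
  have hGn : Measurable fun y => ENNReal.ofReal (-G y) := hGm.neg.ennreal_ofReal
  have hGν : G =ᵐ[ν] fun y => χ₁ y - χ₂ y := by
    filter_upwards [hirr.ae_mem_domJ hμ hν] with y hy using hG y hy
  have hGμ : G =ᵐ[μ] fun y => χ₁ y - χ₂ y := by
    filter_upwards [hirr.ae_mem_domI hμ hν] with y hy using hG y (h.subset hy)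
  have hiG : Integrable G μ := hi.congr hGμ.symm
  have hnG : ∫⁻ y, ENNReal.ofReal (-G y) ∂ν < ⊤ := by
    refine lt_of_eq_of_lt (lintegral_congr_ae ?_) hn
    filter_upwards [hGν] with y hy
    rw [hy, neg_sub]
  have hA : ∀ χ : ℝ → ℝ, Measurable fun x => ∫⁻ y, taylorRem (domI μ ν) (domJ μ ν) χ x y ∂κ x :=
    fun χ => (h.measurable_taylorRem χ).lintegral_kernel_prod_right'
  have hB : ∀ {f : ℝ → ℝ≥0∞}, Measurable f → Measurable fun x => ∫⁻ y, f y ∂κ x :=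
    fun hf => hf.lintegral_kernel
  have hfin' := hfin
  rw [hκ.concaveIntegral_eq hirr hμ hν] at hfin'
  have hnG' := hnG
  rw [← hκ.lintegral_snd hGn] at hnG'
  -- The pointwise balance integrated against `μ`. The right-hand side is finite, hence so is every
  -- term on the left.
  have key : concaveIntegral μ ν χ₁ + ∫⁻ y, ENNReal.ofReal (G y) ∂ν
        + ∫⁻ x, ENNReal.ofReal (-G x) ∂μ =
      concaveIntegral μ ν χ₂ + ∫⁻ y, ENNReal.ofReal (-G y) ∂ν + ∫⁻ x, ENNReal.ofReal (G x) ∂μ := by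
    rw [hκ.concaveIntegral_eq hirr hμ hν, hκ.concaveIntegral_eq hirr hμ hν,
      ← hκ.lintegral_snd hGm.ennreal_ofReal, ← hκ.lintegral_snd hGn,
      ← lintegral_add_left (hA χ₁), ← lintegral_add_right _ hGn,
      ← lintegral_add_left (hA χ₂), ← lintegral_add_right _ hGm.ennreal_ofReal]
    refine lintegral_congr_ae ?_
    filter_upwards [hκ.ae_isSpread hirr hμ hν, ae_lt_top (hA χ₂) hfin'.ne,
      ae_lt_top (hB hGn) hnG'.ne] with x k1 k2 k3
    exact k1.lintegral_taylorRem_balance h hχ₁ hχ₂ hG hGm k2 k3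
  have hpμ : ∫⁻ x, ENNReal.ofReal (G x) ∂μ < ⊤ :=
    (lintegral_mono fun y => Real.ofReal_le_enorm _).trans_lt hiG.hasFiniteIntegral
  have hnμ : ∫⁻ x, ENNReal.ofReal (-G x) ∂μ < ⊤ :=
    (lintegral_mono fun y => Real.ofReal_le_enorm _).trans_lt hiG.neg.hasFiniteIntegral
  have hlt : concaveIntegral μ ν χ₁ + ∫⁻ y, ENNReal.ofReal (G y) ∂ν
        + ∫⁻ x, ENNReal.ofReal (-G x) ∂μ < ⊤ := by
    rw [key]
    exact ENNReal.add_lt_top.2 ⟨ENNReal.add_lt_top.2 ⟨hfin, hnG⟩, hpμ⟩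
  have hlt1 := (ENNReal.add_lt_top.1 (ENNReal.add_lt_top.1 hlt).1).1
  have hpν := (ENNReal.add_lt_top.1 (ENNReal.add_lt_top.1 hlt).1).2
  have hiGν : Integrable G ν := integrable_of_lintegral_pos_neg hGm.aestronglyMeasurable hpν hnG
  refine ⟨hlt1, hiGν.congr hGν, ?_⟩
  rw [← integral_congr_ae hGν, ← integral_congr_ae hGμ,
    integral_eq_lintegral_pos_part_sub_lintegral_neg_part hiGν,
    integral_eq_lintegral_pos_part_sub_lintegral_neg_part hiG]
  have := congrArg ENNReal.toReal key
  rw [ENNReal.toReal_add (ENNReal.add_lt_top.2 ⟨hlt1, hpν⟩).ne hnμ.ne,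
    ENNReal.toReal_add hlt1.ne hpν.ne,
    ENNReal.toReal_add (ENNReal.add_lt_top.2 ⟨hfin, hnG⟩).ne hpμ.ne,
    ENNReal.toReal_add hfin.ne hnG.ne] at this
  linarith

/-- The concave integral does not change if an affine function is added. -/
lemma concaveIntegral_add_affine {χ : ℝ → ℝ} (hχ : ConcaveOn ℝ (domJ μ ν) χ) (a b : ℝ)
    (hχ' : ConcaveOn ℝ (domJ μ ν) fun y => χ y + (a * y + b)) :
    concaveIntegral μ ν (fun y => χ y + (a * y + b)) = concaveIntegral μ ν χ := by
  obtain ⟨κ, hκ⟩ := exists_isMartingaleKernel hμ hν hirr.convexOrder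
  rw [hκ.concaveIntegral_eq hirr hμ hν, hκ.concaveIntegral_eq hirr hμ hν]
  refine lintegral_congr_ae ?_
  filter_upwards [hκ.ae_isSpread hirr hμ hν] with x hx
  exact hx.lintegral_taylorRem_add_affine (hirr.isIntervalPair hμ hν) hχ a b hχ'

/-- The concave integral is lower semicontinuous along nonpositive sequences. -/
theorem concaveIntegral_le_liminf {χn : ℕ → ℝ → ℝ} {χ : ℝ → ℝ}
    (hχn : ∀ n, ConcaveOn ℝ (domJ μ ν) (χn n)) (hχ : ConcaveOn ℝ (domJ μ ν) χ)
    (hneg : ∀ n, ∀ y ∈ domJ μ ν, χn n y ≤ 0)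
    (hlim : ∀ y ∈ domJ μ ν, Tendsto (fun n => χn n y) atTop (𝓝 (χ y))) :
    concaveIntegral μ ν χ ≤ liminf (fun n => concaveIntegral μ ν (χn n)) atTop := by
  obtain ⟨κ, hκ⟩ := exists_isMartingaleKernel hμ hν hirr.convexOrder
  have := hκ.markov
  have h := hirr.isIntervalPair hμ hν
  have hneg' : ∀ y ∈ domJ μ ν, χ y ≤ 0 := fun y hy =>
    le_of_tendsto' (hlim y hy) fun n => hneg n y hy
  simp only [hκ.concaveIntegral_eq hirr hμ hν]
  refine le_trans ?_ (lintegral_liminf_le fun n =>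
    (h.measurable_taylorRem (χn n)).lintegral_kernel_prod_right')
  refine lintegral_mono_ae ?_
  filter_upwards [hκ.ae_isSpread hirr hμ hν] with x hx
  have hxJ := h.subset hx.mem
  have hof : ∀ y ∈ domJ μ ν, Tendsto (fun n => ENNReal.ofReal (-χn n y)) atTop
      (𝓝 (ENNReal.ofReal (-χ y))) := fun y hy =>
    (ENNReal.continuous_ofReal.tendsto _).comp (hlim y hy).neg
  -- After adding the finite number `-χ(x)`, the claim is Fatou's lemma for `-χₙ` under `κ(x)`, as
  -- `-χₙ(x)` converges.
  rw [← ENNReal.add_le_add_iff_right (ENNReal.ofReal_ne_top (r := -χ x)),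
    hx.lintegral_taylorRem_add_ofReal h hχ hneg']
  calc ∫⁻ y, ENNReal.ofReal (-χ y) ∂κ x
      = ∫⁻ y, liminf (fun n => ENNReal.ofReal (-χn n y)) atTop ∂κ x := by
        refine lintegral_congr_ae ?_
        filter_upwards [hx.ae_mem] with y hy using (hof y hy).liminf_eq.symm
    _ ≤ liminf (fun n => ∫⁻ y, ENNReal.ofReal (-χn n y) ∂κ x) atTop :=
        lintegral_liminf_le' fun n => (h.aestronglyMeasurable_concave (hχn n)
          hx.ae_mem).neg.aemeasurable.ennreal_ofReal
    _ = liminf (fun n => ∫⁻ y, taylorRem (domI μ ν) (domJ μ ν) (χn n) x y ∂κ x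
          + ENNReal.ofReal (-χn n x)) atTop := by
        simp only [hx.lintegral_taylorRem_add_ofReal h (hχn _) (hneg _)]
    _ ≤ _ := liminf_add_le_of_tendsto (hof x hxJ)

end Irreducible

/-! ### Compactness of concave functions with bounded concave integral -/

lemma taylorKernel_le_abs (x y z : ℝ) : taylorKernel x y z ≤ |z - y| := by
  unfold taylorKernel
  split_ifs
  · exact max_le ((neg_sub z y) ▸ neg_le_abs _) (abs_nonneg _)
  · exact max_le (le_abs_self _) (abs_nonneg _)

lemma taylorKernel_eq_zero_of_notMem {x y z : ℝ} (h : z ∉ uIcc x y) : taylorKernel x y z = 0 := by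
  rw [mem_uIcc, not_or, not_and_or, not_and_or, not_le, not_le, not_le, not_le] at h
  unfold taylorKernel
  split_ifs with hz
  · exact max_eq_right (by rcases h with ⟨h1 | h1, -⟩ <;> linarith)
  · exact max_eq_right (by rcases h with ⟨-, h1 | h1⟩ <;> linarith)

namespace Irreducible

variable {μ ν : Measure ℝ} [IsFiniteMeasure μ] [IsFiniteMeasure ν] (hirr : Irreducible μ ν)
  (hμ : Integrable (fun x : ℝ => x) μ) (hν : Integrable (fun x : ℝ => x) ν)
include hμ hν

omit [IsFiniteMeasure μ] [IsFiniteMeasure ν] hμ hν in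
lemma potential_lt {z : ℝ} (hz : z ∈ domI μ ν) : 0 < potential ν z - potential μ z :=
  sub_pos.2 hz

lemma exists_pos_le_of_isCompact {K : Set ℝ} (hK : IsCompact K) (hKI : K ⊆ domI μ ν) :
    ∃ δ > 0, ∀ z ∈ K, δ ≤ potential ν z - potential μ z := by
  rcases K.eq_empty_or_nonempty with rfl | hne
  · exact ⟨1, one_pos, fun z hz => absurd hz (notMem_empty z)⟩
  obtain ⟨z₀, hz₀, hmin⟩ := hK.exists_isMinOn hne
    ((continuous_potential hν).sub (continuous_potential hμ)).continuousOn
  exact ⟨_, potential_lt (hKI hz₀), fun z hz => hmin hz⟩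

include hirr

/-- Near an endpoint of `I` that is an atom of `ν`, the difference of the potentials is bounded from
below by a multiple of the distance to the endpoint. -/
lemma exists_Icc_le_of_mem_diff {x₀ b : ℝ} (hx₀ : x₀ ∈ domI μ ν) (hb : b ∈ domJ μ ν \ domI μ ν) :
    ∃ p q, x₀ ∈ Icc p q ∧ Icc p q ⊆ domI μ ν ∧ ∃ c > 0, ∀ z ∈ uIcc x₀ b, z ∉ Icc p q →
      c * |z - b| ≤ potential ν z - potential μ z := by
  obtain ⟨κ, hκ⟩ := exists_isMartingaleKernel hμ hν hirr.convexOrder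
  have := hκ.markov
  have h := hirr.isIntervalPair hμ hν
  have hνb : 0 < ν {b} := by
    rcases hb.1 with h1 | h1
    · exact absurd h1 hb.2
    · exact h1.2
  -- The law of the starting point on the event that the martingale ends in the atom `b`. A compact
  -- `K ⊆ I` carries positive mass of it, and `[p, q]` is the hull of `K` and `x₀`.
  let m : Measure ℝ := ((μ ⊗ₘ κ).restrict (univ ×ˢ {b})).fst
  have hm : ∀ A, MeasurableSet A → m A = (μ ⊗ₘ κ) (A ×ˢ {b}) := fun A hA => by
    rw [Measure.fst_apply hA, Measure.restrict_apply (measurable_fst hA)]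
    congr 1
    ext p
    simp [mem_prod]
  have hpos : 0 < m (domI μ ν) := by
    have h1 : m (domI μ ν) = m univ := by
      refine measure_congr (eventuallyEq_univ.2 ?_)
      have h2 : ∀ᵐ p ∂(μ ⊗ₘ κ), p.1 ∈ domI μ ν :=
        Measure.ae_compProd_of_ae_fst κ h.isOpen.measurableSet (hirr.ae_mem_domI hμ hν)
      exact (ae_map_iff measurable_fst.aemeasurable h.isOpen.measurableSet).2
        (ae_restrict_of_ae h2)
    rw [h1, hm _ MeasurableSet.univ]
    have : (μ ⊗ₘ κ) (univ ×ˢ {b}) = ν {b} := by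
      rw [← hκ.snd_eq, Measure.snd_apply (measurableSet_singleton b), univ_prod]
    rwa [this]
  obtain ⟨K, hKI, hK, hKpos⟩ := h.isOpen.measurableSet.exists_lt_isCompact_of_ne_top
    (measure_ne_top m _) hpos
  have hK' : IsCompact (insert x₀ K) := hK.insert x₀
  have hne : (insert x₀ K).Nonempty := insert_nonempty _ _
  have hsub : insert x₀ K ⊆ domI μ ν := insert_subset hx₀ hKI
  have hKIcc : ∀ x ∈ insert x₀ K, x ∈ Icc (sInf (insert x₀ K)) (sSup (insert x₀ K)) := fun x hx =>
    ⟨csInf_le hK'.bddBelow hx, le_csSup hK'.bddAbove hx⟩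
  have hIcc := h.ordConnected.out (hsub (hK'.sInf_mem hne)) (hsub (hK'.sSup_mem hne))
  refine ⟨_, _, hKIcc x₀ (mem_insert _ _), hIcc, 2 * (m K).toReal,
    mul_pos two_pos (ENNReal.toReal_pos hKpos.ne' (measure_ne_top _ _)), fun z hz hzK => ?_⟩
  -- Such a `z` separates all of `K` from `b`. So the paths from `K` to `b` alone contribute `|z -
  -- b| m(K)` to `(u_ν(z) - u_μ(z))/2`, whence the constant `2 m(K)`.
  have hker : ∀ x ∈ K, taylorKernel x b z = |z - b| := by
    intro x hx
    have hx' := hKIcc x (mem_insert_of_mem _ hx)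
    have hx₀' := hKIcc x₀ (mem_insert _ _)
    rw [mem_Icc, not_and_or, not_le, not_le] at hzK
    rw [mem_uIcc] at hz
    unfold taylorKernel
    rcases h.bound_of_mem_diff hb with hbd | hbd
    · have := hbd x₀ hx₀
      have hxz : x < z := by
        rcases hz with hz | hz <;> rcases hzK with hzK | hzK <;> linarith [hx'.1, hx'.2, hx₀'.1]
      rw [if_pos hxz, abs_sub_comm, abs_of_nonneg, max_eq_left] <;>
        rcases hz with hz | hz <;> linarith
    · have := hbd x₀ hx₀
      have hxz : ¬ x < z := by
        rcases hz with hz | hz <;> rcases hzK with hzK | hzK <;>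
          linarith [hx'.1, hx'.2, hx₀'.1, hx₀'.2]
      rw [if_neg hxz, abs_of_nonneg, max_eq_left] <;>
        rcases hz with hz | hz <;> linarith
  have hKm := hK.measurableSet
  have h1 : ENNReal.ofReal |z - b| * m K ≤ ENNReal.ofReal ((potential ν z - potential μ z) / 2) := by
    rw [← hκ.lintegral_taylorKernel hμ hν z, hm K hKm, ← setLIntegral_const]
    refine le_trans (le_of_eq ?_) (setLIntegral_le_lintegral (K ×ˢ {b}) _)
    refine setLIntegral_congr_fun (hKm.prod (measurableSet_singleton b)) ?_
    rintro ⟨x, y⟩ ⟨hx, hy⟩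
    obtain rfl : y = b := hy
    simp only [hker x hx]
  -- `ENNReal.ofReal` truncates, so the sign is needed. A negative value would force `z = b`, where
  -- `u_μ ≤ u_ν` by continuity.
  have hle : 0 ≤ (potential ν z - potential μ z) / 2 := by
    by_contra! hlt
    have hz0 : ENNReal.ofReal |z - b| * m K = 0 := by
      rw [ENNReal.ofReal_of_nonpos hlt.le] at h1
      exact le_antisymm h1 zero_le
    rcases mul_eq_zero.1 hz0 with h2 | h2
    · rw [ENNReal.ofReal_eq_zero] at h2
      obtain rfl : z = b := by linarith [abs_nonpos_iff.1 h2]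
      have hcl : potential μ z ≤ potential ν z := by
        have : closure (domI μ ν) ⊆ {z | potential μ z ≤ potential ν z} :=
          closure_minimal (fun z hz => le_of_lt (show potential μ z < potential ν z from hz))
            (isClosed_le (continuous_potential hμ) (continuous_potential hν))
        exact this (h.subset_closure hb.1)
      linarith
    · exact hKpos.ne' h2
  have h2 := ENNReal.toReal_mono ENNReal.ofReal_ne_top h1
  rw [ENNReal.toReal_mul, ENNReal.toReal_ofReal (abs_nonneg _), ENNReal.toReal_ofReal hle] at h2
  linarith

/-- The kernel vanishes outside the segment from `x₀` to `y` and is bounded by its length. On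
compact parts of `I` the continuous function `u_ν - u_μ` is bounded away from zero; near an endpoint
`y` both sides are compared with `|z - y|`. -/
lemma exists_taylorKernel_le {x₀ y : ℝ} (hx₀ : x₀ ∈ domI μ ν) (hy : y ∈ domJ μ ν) :
    ∃ C : ℝ, 0 ≤ C ∧ ∀ z ∈ domI μ ν,
      taylorKernel x₀ y z ≤ C * (potential ν z - potential μ z) := by
  have h := hirr.isIntervalPair hμ hν
  have hcompact : ∀ p q, Icc p q ⊆ domI μ ν → ∃ C : ℝ, 0 ≤ C ∧ ∀ z ∈ Icc p q,
      taylorKernel x₀ y z ≤ C * (potential ν z - potential μ z) := by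
    intro p q hpq
    obtain ⟨δ, hδ, hle⟩ := exists_pos_le_of_isCompact hμ hν isCompact_Icc hpq
    refine ⟨|x₀ - y| / δ, by positivity, fun z hz => ?_⟩
    have h1 : taylorKernel x₀ y z ≤ |x₀ - y| := by
      by_cases hzu : z ∈ uIcc x₀ y
      · refine (taylorKernel_le_abs _ _ _).trans ?_
        rw [abs_sub_comm z y, abs_sub_comm x₀ y]
        exact abs_sub_right_of_mem_uIcc hzu
      · rw [taylorKernel_eq_zero_of_notMem hzu]
        exact abs_nonneg _
    calc taylorKernel x₀ y z ≤ |x₀ - y| / δ * δ := by rwa [div_mul_cancel₀ _ hδ.ne']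
      _ ≤ _ := mul_le_mul_of_nonneg_left (hle z hz) (by positivity)
  by_cases hyI : y ∈ domI μ ν
  · obtain ⟨C, hC, hle⟩ := hcompact (min x₀ y) (max x₀ y) (h.ordConnected.uIcc_subset hx₀ hyI)
    refine ⟨C, hC, fun z hz => ?_⟩
    by_cases hzu : z ∈ uIcc x₀ y
    · exact hle z hzu
    · rw [taylorKernel_eq_zero_of_notMem hzu]
      exact mul_nonneg hC (potential_lt hz).le
  · obtain ⟨p, q, -, hpq, c, hc, hle⟩ := hirr.exists_Icc_le_of_mem_diff hμ hν hx₀ ⟨hy, hyI⟩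
    obtain ⟨C, hC, hle'⟩ := hcompact p q hpq
    refine ⟨max C c⁻¹, hC.trans (le_max_left _ _), fun z hz => ?_⟩
    by_cases hzp : z ∈ Icc p q
    · exact (hle' z hzp).trans
        (mul_le_mul_of_nonneg_right (le_max_left _ _) (potential_lt hz).le)
    · refine le_trans ?_
        (mul_le_mul_of_nonneg_right (le_max_right C c⁻¹) (potential_lt hz).le)
      by_cases hzu : z ∈ uIcc x₀ y
      · refine (taylorKernel_le_abs _ _ _).trans ?_
        rw [le_inv_mul_iff₀ hc]
        exact hle z hzu hzp
      · rw [taylorKernel_eq_zero_of_notMem hzu]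
        exact mul_nonneg (inv_nonneg.2 hc.le) (potential_lt hz).le

/-- Taylor's remainder is controlled by the concave integral. -/
theorem exists_taylorRem_le {x₀ y : ℝ} (hx₀ : x₀ ∈ domI μ ν) (hy : y ∈ domJ μ ν) :
    ∃ C : ℝ≥0∞, C ≠ ⊤ ∧ ∀ χ : ℝ → ℝ,
      taylorRem (domI μ ν) (domJ μ ν) χ x₀ y ≤ C * concaveIntegral μ ν χ := by
  have h := hirr.isIntervalPair hμ hν
  obtain ⟨C, hC, hle⟩ := hirr.exists_taylorKernel_le hμ hν hx₀ hy
  -- The factor `2` cancels the `1/2` in `concaveIntegral`.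
  have h1 : ∀ χ : ℝ → ℝ, ∫⁻ z in domI μ ν, ENNReal.ofReal (taylorKernel x₀ y z)
      ∂negSecondDeriv (domI μ ν) χ ≤ ENNReal.ofReal C * 2 * concaveIntegral μ ν χ := by
    intro χ
    calc _ ≤ ∫⁻ z in domI μ ν, ENNReal.ofReal C * ENNReal.ofReal (potential ν z - potential μ z)
          ∂negSecondDeriv (domI μ ν) χ := by
          refine setLIntegral_mono' h.isOpen.measurableSet fun z hz => ?_
          rw [← ENNReal.ofReal_mul hC]
          exact ENNReal.ofReal_le_ofReal (hle z hz)
      _ = ENNReal.ofReal C * 2 * ((1 / 2) * ∫⁻ z in domI μ ν,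
            ENNReal.ofReal (potential ν z - potential μ z) ∂negSecondDeriv (domI μ ν) χ) := by
          rw [lintegral_const_mul' _ _ ENNReal.ofReal_ne_top, ← mul_assoc, mul_assoc _ 2,
            one_div, ENNReal.mul_inv_cancel two_ne_zero ENNReal.ofNat_ne_top, mul_one]
      _ ≤ _ := mul_le_mul_right le_self_add _
  have hCtop : ENNReal.ofReal C * 2 ≠ ⊤ :=
    ENNReal.mul_ne_top ENNReal.ofReal_ne_top ENNReal.ofNat_ne_top
  by_cases hyI : y ∈ domI μ ν
  · refine ⟨_, hCtop, fun χ => ?_⟩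
    rw [taylorRem, indicator_of_notMem (fun hy' => hy'.2 hyI), add_zero]
    exact h1 χ
  · have hνy : ν {y} ≠ 0 := by
      rcases hy with h2 | h2
      · exact absurd h2 hyI
      · exact h2.2.ne'
    -- At an endpoint the jump counts with weight `ν {y} > 0` in the concave integral.
    refine ⟨ENNReal.ofReal C * 2 + (ν {y})⁻¹, ENNReal.add_ne_top.2
      ⟨hCtop, ENNReal.inv_ne_top.2 hνy⟩, fun χ => ?_⟩
    rw [taylorRem, indicator_of_mem (show y ∈ domJ μ ν \ domI μ ν from ⟨hy, hyI⟩), add_mul]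
    refine add_le_add (h1 χ) ?_
    rw [mul_comm, ← div_eq_mul_inv, ENNReal.le_div_iff_mul_le (Or.inl hνy)
      (Or.inl (measure_ne_top _ _))]
    have hsub : {y} ⊆ domJ μ ν \ domI μ ν := singleton_subset_iff.2 ⟨hy, hyI⟩
    calc _ = ∫⁻ b in {y}, ENNReal.ofReal (jump (domI μ ν) χ b) ∂ν := by
          rw [lintegral_singleton]
      _ ≤ ∫⁻ b in domJ μ ν \ domI μ ν, ENNReal.ofReal (jump (domI μ ν) χ b) ∂ν :=
          lintegral_mono_set hsub
      _ ≤ _ := le_add_self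

end Irreducible

/-- **Helly's selection theorem** for convex functions on an interval. -/
theorem exists_subseq_tendsto_of_convexOn {I J : Set ℝ} (h : IsIntervalPair I J)
    {u : ℕ → ℝ → ℝ} (hu : ∀ n, ConvexOn ℝ J (u n)) (h0 : ∀ n, ∀ y ∈ J, 0 ≤ u n y)
    (hb : ∀ y ∈ J, ∃ C, ∀ n, u n y ≤ C) :
    ∃ k : ℕ → ℕ, StrictMono k ∧ ∃ v : ℝ → ℝ,
      ∀ y ∈ J, Tendsto (fun n => u (k n) y) atTop (𝓝 (v y)) := by
  choose! C hC using hb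
  -- The endpoints are included because convex functions may jump there, so that convergence on `I`
  -- says nothing about them.
  let Q : Set ℝ := (I ∩ range ((↑) : ℚ → ℝ)) ∪ (J \ I)
  have hQc : Q.Countable := ((countable_range _).mono inter_subset_right).union
    h.finite_diff.countable
  have hQJ : Q ⊆ J := union_subset (inter_subset_left.trans h.subset) sdiff_subset
  have : Countable Q := hQc.to_subtype
  have hcomp : IsCompact (Set.pi univ fun q : Q => Icc 0 (C q)) :=
    isCompact_univ_pi fun _ => isCompact_Icc
  obtain ⟨a, -, k, hk, hlim⟩ := hcomp.tendsto_subseq (x := fun n (q : Q) => u n q)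
    fun n q _ => ⟨h0 n q (hQJ q.2), hC q (hQJ q.2) n⟩
  rw [tendsto_pi_nhds] at hlim
  refine ⟨k, hk, ?_⟩
  suffices ∀ y ∈ J, ∃ l, Tendsto (fun n => u (k n) y) atTop (𝓝 l) by
    choose! v hv using this
    exact ⟨v, hv⟩
  intro y hy
  by_cases hyI : y ∈ I
  swap
  · exact ⟨_, hlim ⟨y, Or.inr ⟨hy, hyI⟩⟩⟩
  refine cauchySeq_tendsto_of_complete (Metric.cauchySeq_iff'.2 fun ε hε => ?_)
  obtain ⟨r, hr, hball⟩ := Metric.nhds_basis_closedBall.mem_iff.1 (h.isOpen.mem_nhds hyI)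
  have hball' : Metric.closedBall y r ⊆ J := hball.trans h.subset
  rw [Real.closedBall_eq_Icc] at hball'
  set M := max (C (y - r)) (C (y + r))
  have hl : y - r ∈ J := hball' ⟨le_rfl, by linarith⟩
  have hr' : y + r ∈ J := hball' ⟨by linarith, le_rfl⟩
  -- Nonnegativity and the bounds at `y ± r` bound all `u n` uniformly on the ball, which yields a
  -- common Lipschitz constant on the ball of half the radius.
  have hlip : ∀ n, LipschitzOnWith (2 * M / (r / 2)).toNNReal (u n) (Metric.ball y (r - r / 2)) := by
    intro n
    have hsub : Metric.ball y r ⊆ J := (Metric.ball_subset_closedBall).trans (hball.trans h.subset)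
    refine ((hu n).subset hsub (convex_ball y r)).lipschitzOnWith_of_abs_le (by positivity)
      fun z hz => ?_
    have hzJ : z ∈ Icc (y - r) (y + r) := by
      rw [← Real.closedBall_eq_Icc]; exact hz.le
    rw [abs_of_nonneg (h0 n z (hball' hzJ))]
    exact ((hu n).le_max_of_mem_Icc hl hr' hzJ).trans (max_le_max (hC _ hl n) (hC _ hr' n))
  set K := (2 * M / (r / 2)).toNNReal
  have hρ : 0 < min (r / 2) (ε / (3 * (K + 1))) := by positivity
  obtain ⟨q, hq1, hq2⟩ := exists_rat_btwn (show y < y + min (r / 2) (ε / (3 * (K + 1))) by linarith)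
  have hqr : (q : ℝ) < y + r / 2 := hq2.trans_le (by linarith [min_le_left (r / 2) (ε / (3 * (K + 1)))])
  have hqI : (q : ℝ) ∈ I := hball (by
    rw [Real.closedBall_eq_Icc]; constructor <;> linarith)
  have hd : ∀ n, dist (u n y) (u n q) < ε / 3 := by
    intro n
    refine ((hlip n).dist_le_mul y (Metric.mem_ball_self (by linarith)) q ?_).trans_lt ?_
    · rw [Metric.mem_ball, Real.dist_eq, abs_of_pos (by linarith)]; linarith
    · have h1 : dist y (q : ℝ) ≤ ε / (3 * (K + 1)) := by
        rw [Real.dist_eq, abs_sub_comm, abs_of_pos (by linarith)]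
        linarith [min_le_right (r / 2) (ε / (3 * (K + 1)))]
      calc (K : ℝ) * dist y q ≤ K * (ε / (3 * (K + 1))) := by gcongr
        _ < (K + 1) * (ε / (3 * (K + 1))) := by
            have : 0 < ε / (3 * ((K : ℝ) + 1)) := by positivity
            nlinarith
        _ = ε / 3 := by field_simp
  obtain ⟨N, hN⟩ := Metric.cauchySeq_iff'.1
    (hlim ⟨q, Or.inl ⟨hqI, mem_range_self q⟩⟩).cauchySeq (ε / 3) (by positivity)
  refine ⟨N, fun n hn => ?_⟩
  have h1 := hd (k n)
  have h2 := hd (k N)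
  have h3 : dist (u (k n) q) (u (k N) q) < ε / 3 := hN n hn
  rw [dist_comm] at h2
  have h4 := dist_triangle4 (u (k n) y) (u (k n) q) (u (k N) q) (u (k N) y)
  linarith

/-! ### Feasible pairs are finite -/

lemma IsIntervalPair.convex {I J : Set ℝ} (h : IsIntervalPair I J) : Convex ℝ J := by
  refine OrdConnected.convex ⟨fun a ha b hb z hz => ?_⟩
  rcases hz.1.eq_or_lt with rfl | h1
  · exact ha
  rcases hz.2.eq_or_lt with rfl | h2
  · exact hb
  exact h.subset (h.mem_of_lt_of_lt ha hb h1 h2)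

lemma EConcaveOn.concaveOn_toReal {J : Set ℝ} (hJ : Convex ℝ J) {φ : ℝ → EReal}
    (hφ : EConcaveOn J φ) (hfin : ∀ y ∈ J, φ y ≠ ⊤ ∧ φ y ≠ ⊥) :
    ConcaveOn ℝ J fun y => (φ y).toReal := by
  refine ⟨hJ, fun x hx y hy a b ha hb hab => ?_⟩
  have hmem : ∀ z ∈ J, ((z, (φ z).toReal) : ℝ × ℝ) ∈ {p : ℝ × ℝ | p.1 ∈ J ∧ (p.2 : EReal) ≤ φ p.1} :=
    fun z hz => ⟨hz, (EReal.coe_toReal (hfin z hz).1 (hfin z hz).2).le⟩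
  obtain ⟨h1, h2⟩ := hφ (hmem x hx) (hmem y hy) ha hb hab
  change a • x + b • y ∈ J at h1
  change ((a • (φ x).toReal + b • (φ y).toReal : ℝ) : EReal) ≤ φ (a • x + b • y) at h2
  rwa [← EReal.coe_le_coe_iff, EReal.coe_toReal (hfin _ h1).1 (hfin _ h1).2]

lemma EConvexOn.convexOn_toReal {J : Set ℝ} (hJ : Convex ℝ J) {ψ : ℝ → EReal}
    (hψ : EConvexOn J ψ) (hfin : ∀ y ∈ J, ψ y ≠ ⊤ ∧ ψ y ≠ ⊥) :
    ConvexOn ℝ J fun y => (ψ y).toReal := by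
  refine ⟨hJ, fun x hx y hy a b ha hb hab => ?_⟩
  have hmem : ∀ z ∈ J, ((z, (ψ z).toReal) : ℝ × ℝ) ∈ {p : ℝ × ℝ | p.1 ∈ J ∧ ψ p.1 ≤ (p.2 : EReal)} :=
    fun z hz => ⟨hz, (EReal.coe_toReal (hfin z hz).1 (hfin z hz).2).ge⟩
  obtain ⟨h1, h2⟩ := hψ (hmem x hx) (hmem y hy) ha hb hab
  change a • x + b • y ∈ J at h1
  change ψ (a • x + b • y) ≤ ((a • (ψ x).toReal + b • (ψ y).toReal : ℝ) : EReal) at h2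
  rwa [← EReal.coe_le_coe_iff, EReal.coe_toReal (hfin _ h1).1 (hfin _ h1).2]

lemma econcaveOn_coe {J : Set ℝ} {φ : ℝ → ℝ} (hφ : ConcaveOn ℝ J φ) :
    EConcaveOn J fun y => (φ y : EReal) := by
  have := hφ.convex_hypograph
  simpa only [EConcaveOn, EReal.coe_le_coe_iff] using this

lemma econvexOn_coe {J : Set ℝ} {ψ : ℝ → ℝ} (hψ : ConvexOn ℝ J ψ) :
    EConvexOn J fun y => (ψ y : EReal) := by
  have := hψ.convex_epigraph
  simpa only [EConvexOn, EReal.coe_le_coe_iff] using this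

/-- An extended-valued concave function that is finite at an interior point is nowhere `∞`. -/
lemma EConcaveOn.ne_top {I J : Set ℝ} (h : IsIntervalPair I J) {φ : ℝ → EReal}
    (hφ : EConcaveOn J φ) (hbot : ∀ y ∈ J, φ y ≠ ⊥) {x : ℝ} (hx : x ∈ I) (hxt : φ x ≠ ⊤) :
    ∀ y ∈ J, φ y ≠ ⊤ := by
  intro y hy hyt
  have hxy : x ≠ y := fun he => hxt (he ▸ hyt)
  have : ∃ y' ∈ I, x ∈ openSegment ℝ y y' := by
    rcases hxy.lt_or_gt with hlt | hlt
    · have hmem : I ∈ 𝓝[<] x := mem_nhdsWithin_of_mem_nhds (h.isOpen.mem_nhds hx)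
      obtain ⟨y', h1, h2⟩ := ((eventually_mem_set.2 hmem).and self_mem_nhdsWithin).exists
      have h2' : y' < x := h2
      exact ⟨y', h1, by rw [openSegment_symm, openSegment_eq_Ioo (h2'.trans hlt)]; exact ⟨h2, hlt⟩⟩
    · have hmem : I ∈ 𝓝[>] x := mem_nhdsWithin_of_mem_nhds (h.isOpen.mem_nhds hx)
      obtain ⟨y', h1, h2⟩ := ((eventually_mem_set.2 hmem).and self_mem_nhdsWithin).exists
      have h2' : x < y' := h2
      exact ⟨y', h1, by rw [openSegment_eq_Ioo (hlt.trans h2')]; exact ⟨hlt, h2⟩⟩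
  obtain ⟨y', hy', a, b, ha, hb, hab, rfl⟩ := this
  set z := a • y + b • y'
  set s := (φ y').toReal
  have hmem : ((y', s) : ℝ × ℝ) ∈ {p : ℝ × ℝ | p.1 ∈ J ∧ (p.2 : EReal) ≤ φ p.1} :=
    ⟨h.subset hy', EReal.coe_toReal_le (hbot y' (h.subset hy'))⟩
  -- Since `φ y = ∞`, any height is allowed at `y`; this one makes the convex combination at `z`
  -- equal to `φ z + 1`.
  have hmem' : ((y, ((φ z).toReal + 1 - b * s) / a) : ℝ × ℝ) ∈
      {p : ℝ × ℝ | p.1 ∈ J ∧ (p.2 : EReal) ≤ φ p.1} := ⟨hy, by rw [hyt]; exact le_top⟩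
  have h2 := (hφ hmem' hmem ha.le hb.le hab).2
  have e : (a • ((y, ((φ z).toReal + 1 - b * s) / a) : ℝ × ℝ) + b • ((y', s) : ℝ × ℝ)) =
      (z, (φ z).toReal + 1) := by
    ext
    · rfl
    · simp only [Prod.snd_add, Prod.smul_snd, smul_eq_mul]
      field_simp
      ring
  rw [e] at h2
  simp only at h2
  rw [← EReal.coe_toReal hxt (hbot z (h.subset hx)), EReal.coe_le_coe_iff, EReal.toReal_coe] at h2
  linarith

namespace Irreducible

variable {μ ν : Measure ℝ} [IsFiniteMeasure μ] [IsFiniteMeasure ν] (hirr : Irreducible μ ν)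
  (hμ : Integrable (fun x : ℝ => x) μ) (hν : Integrable (fun x : ℝ => x) ν)
include hirr hμ hν

lemma restrict_domJ_left : μ.restrict (domJ μ ν) = μ :=
  Measure.restrict_eq_self_of_ae_mem <| by
    filter_upwards [hirr.ae_mem_domI hμ hν] with x hx using
      (hirr.isIntervalPair hμ hν).subset hx

lemma restrict_domJ_right : ν.restrict (domJ μ ν) = ν :=
  Measure.restrict_eq_self_of_ae_mem (hirr.ae_mem_domJ hμ hν)

lemma ne_zero_left (hne : (domI μ ν).Nonempty) : μ ≠ 0 := by
  rintro rfl
  obtain ⟨x, hx⟩ := hne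
  have h5 := hirr.convexOrder.integral_affine hν 0 1
  simp only [zero_mul, zero_add, integral_const, smul_eq_mul, mul_one] at h5
  rw [eq_comm, measureReal_zero_apply, measureReal_eq_zero_iff, Measure.measure_univ_eq_zero] at h5
  have := hirr.measure_Iio_pos hμ hν hx
  simp [h5] at this

/-- In `EReal`, `⊥ + ⊤ = ⊥`, so a nonnegative sum excludes `-∞` for both functions. The moderator
makes `φ` finite at some point of `I`, and concavity spreads this over `J`. It also makes `ψ` finite
`ν`-almost everywhere: at the atoms, and on both sides of each point of `I`, where convexity
applies. -/
lemma dualFeasible_finite (hne : (domI μ ν).Nonempty) {f φ ψ : ℝ → EReal}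
    (hf : ∀ x ∈ domJ μ ν, 0 ≤ f x) (hfeas : DualFeasible μ ν f φ ψ) :
    ∀ y ∈ domJ μ ν, (φ y ≠ ⊤ ∧ φ y ≠ ⊥) ∧ (ψ y ≠ ⊤ ∧ ψ y ≠ ⊥) := by
  have h := hirr.isIntervalPair hμ hν
  obtain ⟨χ, hχ, -⟩ := hfeas.memLc.moderator
  have hsum : ∀ y ∈ domJ μ ν, 0 ≤ φ y + ψ y := fun y hy => (hf y hy).trans (hfeas.superhedge y hy)
  have hφb : ∀ y ∈ domJ μ ν, φ y ≠ ⊥ := fun y hy he => by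
    have := hsum y hy
    rw [he, EReal.bot_add] at this
    simp at this
  have hψb : ∀ y ∈ domJ μ ν, ψ y ≠ ⊥ := fun y hy he => by
    have := hsum y hy
    rw [he, EReal.add_bot] at this
    simp at this
  have hl := hχ.left.1
  have hr := hχ.right.1
  rw [hirr.restrict_domJ_left hμ hν] at hl
  rw [hirr.restrict_domJ_right hμ hν] at hr
  have : (ae μ).NeBot := ae_neBot.2 (hirr.ne_zero_left hμ hν hne)
  obtain ⟨x, hx, hxI⟩ := (hl.and (hirr.ae_mem_domI hμ hν)).exists
  have hφt := hfeas.concave.ne_top h hφb hxI hx.1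
  refine fun y hy => ⟨⟨hφt y hy, hφb y hy⟩, ?_, hψb y hy⟩
  have hex : ∀ A : Set ℝ, 0 < ν A → ∃ z ∈ A, z ∈ domJ μ ν ∧ ψ z ≠ ⊤ := by
    intro A hA
    have h1 : ∃ᵐ z ∂ν, z ∈ A := by
      rw [frequently_ae_mem_iff]
      exact hA.ne'
    obtain ⟨z, hz, hz1, hz2⟩ := (h1.and_eventually (hr.and (hirr.ae_mem_domJ hμ hν))).exists
    exact ⟨z, hz, hz2, hz1.1⟩
  rcases hy with hyI | hyb
  · obtain ⟨z, hzy, hzJ, hzt⟩ := hex _ (hirr.measure_Iio_pos hμ hν hyI)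
    obtain ⟨w, hyw, hwJ, hwt⟩ := hex _ (hirr.measure_Ioi_pos hμ hν hyI)
    have hmem : ∀ v ∈ domJ μ ν, ψ v ≠ ⊤ → ((v, (ψ v).toReal) : ℝ × ℝ) ∈
        {p : ℝ × ℝ | p.1 ∈ domJ μ ν ∧ ψ p.1 ≤ (p.2 : EReal)} :=
      fun v hv hvt => ⟨hv, (EReal.coe_toReal hvt (hψb v hv)).ge⟩
    have hys : y ∈ openSegment ℝ z w := by
      rw [openSegment_eq_Ioo (lt_trans hzy hyw)]
      exact ⟨hzy, hyw⟩
    obtain ⟨a, b, ha, hb, hab, rfl⟩ := hys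
    have h2 := (hfeas.convex (hmem z hzJ hzt) (hmem w hwJ hwt) ha.le hb.le hab).2
    exact (h2.trans_lt (EReal.coe_lt_top _)).ne
  · obtain ⟨z, hz, -, hzt⟩ := hex _ hyb.2
    obtain rfl : z = y := hz
    exact hzt

/-- The generalized integral of a pair whose first component is concave. -/
theorem genIntegral_eq {φ ψ : ℝ → EReal} (hφ : ConcaveOn ℝ (domJ μ ν) fun y => (φ y).toReal)
    (hs : ∀ y ∈ domJ μ ν, 0 ≤ (φ y).toReal + (ψ y).toReal)
    (hmod : ∃ χ, IsConcaveModerator μ ν φ ψ χ) (hfin : genIntegral μ ν φ ψ < ⊤) :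
    concaveIntegral μ ν (fun y => (φ y).toReal) < ⊤ ∧
      Integrable (fun y => (φ y).toReal + (ψ y).toReal) ν ∧
      genIntegral μ ν φ ψ = ((concaveIntegral μ ν (fun y => (φ y).toReal)).toReal
        + ∫ y, ((φ y).toReal + (ψ y).toReal) ∂ν : ℝ) := by
  rw [genIntegral, dif_pos hmod, moderatedIntegral] at hfin ⊢
  have hχ := hmod.choose_spec
  set χ := hmod.choose
  rw [hirr.restrict_domJ_left hμ hν, hirr.restrict_domJ_right hμ hν] at hfin ⊢
  -- The chosen moderator is arbitrary, but an infinite concave integral would make the value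
  -- infinite.
  have hχfin : concaveIntegral μ ν χ < ⊤ := by
    by_contra hcon
    rw [not_lt_top_iff.1 hcon, EReal.coe_ennreal_top, EReal.coe_add_top] at hfin
    exact lt_irrefl _ hfin
  have hi1 : Integrable (fun x => (φ x).toReal - χ x) μ := by
    have := hχ.left.2
    rw [IntegrableOn, hirr.restrict_domJ_left hμ hν] at this
    simpa only [sub_eq_add_neg] using this
  have hi2 : Integrable (fun x => (ψ x).toReal + χ x) ν := by
    have := hχ.right.2
    rwa [IntegrableOn, hirr.restrict_domJ_right hμ hν] at this
  -- The negative part of `φ - χ` is `ν`-integrable because `χ - φ ≤ ψ + χ ∈ L¹(ν)`.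
  obtain ⟨h1, h2, h3⟩ := hirr.concaveIntegral_change hμ hν hφ hχ.concave hi1 (by
    refine (lintegral_mono_ae ?_).trans_lt hi2.hasFiniteIntegral
    filter_upwards [hirr.ae_mem_domJ hμ hν] with y hy
    refine le_trans (ENNReal.ofReal_le_ofReal ?_) (Real.ofReal_le_enorm _)
    linarith [hs y hy]) hχfin
  have hsum : ∀ y, (φ y).toReal + (ψ y).toReal =
      ((φ y).toReal - χ y) + ((ψ y).toReal + χ y) := fun y => by ring
  refine ⟨h1, (h2.add hi2).congr (ae_of_all _ fun y => (hsum y).symm), ?_⟩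
  have hc : (concaveIntegral μ ν χ : EReal) = ((concaveIntegral μ ν χ).toReal : EReal) :=
    (EReal.coe_ennreal_toReal hχfin.ne).symm
  rw [hc, ← EReal.coe_add]
  simp only [hsum]
  rw [integral_add h2 hi2]
  congr 1
  linarith

/-- A concave function is a moderator as soon as its concave integral is finite; the generalized
integral can be computed with it. -/
theorem genIntegral_eq_of_concaveIntegral_lt_top {φ ψ : ℝ → ℝ} (hφ : ConcaveOn ℝ (domJ μ ν) φ)
    (hs : ∀ y ∈ domJ μ ν, 0 ≤ φ y + ψ y) (hc : concaveIntegral μ ν φ < ⊤)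
    (hi : Integrable (fun y => φ y + ψ y) ν) :
    IsConcaveModerator μ ν (fun y => (φ y : EReal)) (fun y => (ψ y : EReal)) φ ∧
      genIntegral μ ν (fun y => (φ y : EReal)) (fun y => (ψ y : EReal)) =
        ((concaveIntegral μ ν φ).toReal + ∫ y, (φ y + ψ y) ∂ν : ℝ) := by
  have hm : IsConcaveModerator μ ν (fun y => (φ y : EReal)) (fun y => (ψ y : EReal)) φ := by
    refine ⟨hφ, ⟨by simp, ?_⟩, ⟨by simp, ?_⟩⟩
    · simp
    · rw [IntegrableOn, hirr.restrict_domJ_right hμ hν]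
      simpa only [EReal.toReal_coe, add_comm] using hi
  refine ⟨hm, ?_⟩
  have hmod : ∃ χ, IsConcaveModerator μ ν (fun y => (φ y : EReal)) (fun y => (ψ y : EReal)) χ :=
    ⟨φ, hm⟩
  refine (hirr.genIntegral_eq hμ hν (φ := fun y => (φ y : EReal))
    (ψ := fun y => (ψ y : EReal)) hφ hs hmod ?_).2.2
  rw [genIntegral, dif_pos hmod, moderatedIntegral]
  have hχ := hmod.choose_spec
  set χ := hmod.choose
  have hi1 : Integrable (fun x => χ x - φ x) μ := by
    have := hχ.left.2
    rw [IntegrableOn, hirr.restrict_domJ_left hμ hν] at this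
    refine this.neg.congr (ae_of_all _ fun x => ?_)
    simp only [Pi.neg_apply, EReal.toReal_coe]
    ring
  have hi2 : Integrable (fun x => ψ x + χ x) ν := by
    have := hχ.right.2
    rwa [IntegrableOn, hirr.restrict_domJ_right hμ hν] at this
  have hi3 : Integrable (fun x => φ x - χ x) ν :=
    (hi.sub hi2).congr (ae_of_all _ fun x => by simp only [Pi.sub_apply]; ring)
  -- Used in the other direction: finiteness passes from `φ` to the chosen moderator.
  obtain ⟨h1, -, -⟩ := hirr.concaveIntegral_change hμ hν hχ.concave hφ hi1
    ((lintegral_mono fun y => Real.ofReal_le_enorm _).trans_lt hi3.hasFiniteIntegral) hc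
  rw [← EReal.coe_ennreal_toReal h1.ne, ← EReal.coe_add]
  exact EReal.coe_lt_top _

end Irreducible

/-! ### The closedness of the dual space -/

lemma concaveOn_affine {J : Set ℝ} (hJ : Convex ℝ J) (a b : ℝ) :
    ConcaveOn ℝ J fun y => a * y + b := by
  refine ⟨hJ, fun x _ y _ s t _ _ hst => le_of_eq ?_⟩
  simp only [smul_eq_mul]
  obtain rfl : s = 1 - t := by linarith
  ring

lemma convexOn_of_tendsto {J : Set ℝ} {u : ℕ → ℝ → ℝ} {v : ℝ → ℝ} (hu : ∀ n, ConvexOn ℝ J (u n))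
    (hlim : ∀ y ∈ J, Tendsto (fun n => u n y) atTop (𝓝 (v y))) : ConvexOn ℝ J v := by
  have hJ := (hu 0).1
  refine ⟨hJ, fun x hx y hy a b ha hb hab => ?_⟩
  exact le_of_tendsto_of_tendsto' (hlim _ (hJ hx hy ha hb hab))
    (((hlim x hx).const_mul a).add ((hlim y hy).const_mul b)) fun n => (hu n).2 hx hy ha hb hab

lemma le_liminf_add_ennreal (u v : ℕ → ℝ≥0∞) :
    liminf u atTop + liminf v atTop ≤ liminf (fun n => u n + v n) atTop := by
  rw [liminf_eq_iSup_iInf_of_nat, liminf_eq_iSup_iInf_of_nat, liminf_eq_iSup_iInf_of_nat,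
    ENNReal.iSup_add_iSup_of_monotone
      (fun i j hij => le_iInf₂ fun n hn => iInf₂_le n (hij.trans hn))
      (fun i j hij => le_iInf₂ fun n hn => iInf₂_le n (hij.trans hn))]
  exact iSup_mono fun i => le_iInf₂ fun n hn => add_le_add (iInf₂_le n hn) (iInf₂_le n hn)

namespace Irreducible

variable {μ ν : Measure ℝ} [IsFiniteMeasure μ] [IsFiniteMeasure ν] (hirr : Irreducible μ ν)
  (hμ : Integrable (fun x : ℝ => x) μ) (hν : Integrable (fun x : ℝ => x) ν)
include hirr hμ hν

/-- A sequence of nonnegative convex functions that is dominated by a pointwise bounded sequence of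
convex functions up to an error that is bounded in `L¹(ν)` is pointwise bounded. -/
lemma exists_bound_of_lintegral_le {u v : ℕ → ℝ → ℝ} (hu : ∀ n, ConvexOn ℝ (domJ μ ν) (u n))
    (hv : ∀ n, ConvexOn ℝ (domJ μ ν) (v n)) (hub : ∀ y ∈ domJ μ ν, ∃ C, ∀ n, u n y ≤ C)
    {B : ℝ≥0∞} (hB : B ≠ ⊤) (hbd : ∀ n, ∫⁻ y, ENNReal.ofReal (v n y - u n y) ∂ν ≤ B) :
    ∀ y ∈ domJ μ ν, ∃ C, ∀ n, v n y ≤ C := by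
  have h := hirr.isIntervalPair hμ hν
  choose! C hC using hub
  -- By convexity `u n ≤ A` on `K`. If `v n` exceeded `A + S + 1` on all of `K`, with `S = B /
  -- ν(K)`, the integral of `v n - u n` would exceed `B`. The good point depends on `n`.
  have key : ∀ K : Set ℝ, IsCompact K → K ⊆ domJ μ ν → 0 < ν K →
      ∃ C', ∀ n, ∃ l ∈ K, v n l ≤ C' := by
    intro K hK hKJ hpos
    have hne : K.Nonempty := nonempty_of_measure_ne_zero hpos.ne'
    have hp := hK.sInf_mem hne
    have hq := hK.sSup_mem hne
    set A := max (C (sInf K)) (C (sSup K))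
    have hA : ∀ n, ∀ l ∈ K, u n l ≤ A := fun n l hl =>
      ((hu n).le_max_of_mem_Icc (hKJ hp) (hKJ hq)
        ⟨csInf_le hK.bddBelow hl, le_csSup hK.bddAbove hl⟩).trans
        (max_le_max (hC _ (hKJ hp) n) (hC _ (hKJ hq) n))
    set S := (B / ν K).toReal
    refine ⟨A + (S + 1), fun n => ?_⟩
    by_contra! hcon
    have h1 : ENNReal.ofReal (S + 1) * ν K ≤ B := by
      rw [← setLIntegral_const]
      refine le_trans (setLIntegral_mono' hK.measurableSet fun l hl => ?_)
        ((setLIntegral_le_lintegral K _).trans (hbd n))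
      exact ENNReal.ofReal_le_ofReal (by linarith [hcon l hl, hA n l hl])
    rw [← ENNReal.le_div_iff_mul_le (Or.inl hpos.ne') (Or.inl (measure_ne_top _ _)),
      ENNReal.ofReal_le_iff_le_toReal (ENNReal.div_ne_top hB hpos.ne')] at h1
    linarith
  intro y hy
  rcases hy with hyI | hyb
  · have hex : ∀ A : Set ℝ, MeasurableSet A → 0 < ν A → ∃ C', ∀ n, ∃ l ∈ A, l ∈ domJ μ ν ∧
        v n l ≤ C' := by
      intro A hA hpos
      have hpos' : 0 < ν (A ∩ domJ μ ν) := by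
        rwa [← Measure.restrict_apply hA, hirr.restrict_domJ_right hμ hν]
      obtain ⟨K, hKs, hK, hKpos⟩ := (hA.inter h.measurableSet).exists_lt_isCompact_of_ne_top
        (measure_ne_top ν _) hpos'
      obtain ⟨C', hC'⟩ := key K hK (hKs.trans inter_subset_right) hKpos
      refine ⟨C', fun n => ?_⟩
      obtain ⟨l, hl, hle⟩ := hC' n
      exact ⟨l, (hKs hl).1, (hKs hl).2, hle⟩
    obtain ⟨C₁, h₁⟩ := hex _ measurableSet_Iio (hirr.measure_Iio_pos hμ hν hyI)
    obtain ⟨C₂, h₂⟩ := hex _ measurableSet_Ioi (hirr.measure_Ioi_pos hμ hν hyI)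
    -- The points on the two sides of `y` vary with `n`, but convexity needs only the bounds on the
    -- values there.
    refine ⟨max C₁ C₂, fun n => ?_⟩
    obtain ⟨l, hl, hlJ, hlC⟩ := h₁ n
    obtain ⟨r, hr, hrJ, hrC⟩ := h₂ n
    exact ((hv n).le_max_of_mem_Icc hlJ hrJ ⟨le_of_lt hl, le_of_lt hr⟩).trans
      (max_le_max hlC hrC)
  · obtain ⟨C', hC'⟩ := key {y} isCompact_singleton (singleton_subset_iff.2 (Or.inr hyb)) hyb.2
    refine ⟨C', fun n => ?_⟩
    obtain ⟨l, rfl, hl⟩ := hC' n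
    exact hl

/-- Compactness: pairs of a concave and a convex function with bounded generalized integral
converge along a subsequence, up to adding affine functions. -/
theorem exists_subseq_tendsto (hne : (domI μ ν).Nonempty) {p q : ℕ → ℝ → ℝ}
    (hp : ∀ n, ConcaveOn ℝ (domJ μ ν) (p n)) (hq : ∀ n, ConvexOn ℝ (domJ μ ν) (q n))
    (hs : ∀ n, ∀ y ∈ domJ μ ν, 0 ≤ p n y + q n y) {B : ℝ≥0∞} (hB : B ≠ ⊤)
    (hbd : ∀ n, concaveIntegral μ ν (p n) + ∫⁻ y, ENNReal.ofReal (p n y + q n y) ∂ν ≤ B) :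
    ∃ k : ℕ → ℕ, StrictMono k ∧ ∃ a b : ℝ → ℝ, ConcaveOn ℝ (domJ μ ν) a ∧
      ConvexOn ℝ (domJ μ ν) b ∧
      (∀ y ∈ domJ μ ν, Tendsto (fun n => p (k n) y + q (k n) y) atTop (𝓝 (a y + b y))) ∧
      concaveIntegral μ ν a + ∫⁻ y, ENNReal.ofReal (a y + b y) ∂ν ≤
        liminf (fun n => concaveIntegral μ ν (p (k n))
          + ∫⁻ y, ENNReal.ofReal (p (k n) y + q (k n) y) ∂ν) atTop := by
  have h := hirr.isIntervalPair hμ hν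
  have hJ := h.convex
  obtain ⟨x₀, hx₀⟩ := hne
  -- `-(m n * y + β n)` is the tangent of `p n` at `x₀`. With it subtracted, `-χ n` becomes the
  -- Taylor gap of `p n`.
  let m : ℕ → ℝ := fun n => negRightDeriv (p n) x₀
  let β : ℕ → ℝ := fun n => -(p n x₀) - m n * x₀
  let χ : ℕ → ℝ → ℝ := fun n y => p n y + (m n * y + β n)
  let v : ℕ → ℝ → ℝ := fun n y => q n y - (m n * y + β n)
  have hχ : ∀ n, ConcaveOn ℝ (domJ μ ν) (χ n) := fun n => (hp n).add (concaveOn_affine hJ _ _)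
  have hv : ∀ n, ConvexOn ℝ (domJ μ ν) (v n) := fun n => (hq n).sub (concaveOn_affine hJ _ _)
  have hχc : ∀ n, concaveIntegral μ ν (χ n) = concaveIntegral μ ν (p n) := fun n =>
    hirr.concaveIntegral_add_affine hμ hν (hp n) _ _ (hχ n)
  have hsum : ∀ n y, χ n y + v n y = p n y + q n y := fun n y => by simp only [χ, v]; ring
  have hgap : ∀ n y, -χ n y = taylorGap (p n) x₀ y := fun n y => by
    simp only [χ, β, m, taylorGap]; ring
  have hu : ∀ n, ConvexOn ℝ (domJ μ ν) fun y => -χ n y := fun n => (hχ n).neg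
  have hu0 : ∀ n, ∀ y ∈ domJ μ ν, 0 ≤ -χ n y := fun n y hy => by
    rw [hgap]; exact (taylorRem_eq h (hp n) hx₀ hy).1
  have hub : ∀ y ∈ domJ μ ν, ∃ C, ∀ n, -χ n y ≤ C := by
    intro y hy
    obtain ⟨C, hC, hle⟩ := hirr.exists_taylorRem_le hμ hν hx₀ hy
    refine ⟨(C * B).toReal, fun n => ?_⟩
    rw [← ENNReal.ofReal_le_iff_le_toReal (ENNReal.mul_ne_top hC hB), hgap,
      ← (taylorRem_eq h (hp n) hx₀ hy).2]
    exact (hle (p n)).trans (mul_le_mul_right (le_self_add.trans (hbd n)) C)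
  have hv0 : ∀ n, ∀ y ∈ domJ μ ν, 0 ≤ v n y := fun n y hy => by
    have := hs n y hy
    rw [← hsum] at this
    linarith [hu0 n y hy]
  have hvb := hirr.exists_bound_of_lintegral_le hμ hν hu hv hub hB (fun n => by
    refine le_trans (le_of_eq (lintegral_congr fun y => ?_)) (le_add_self.trans (hbd n))
    rw [← hsum, sub_neg_eq_add, add_comm])
  obtain ⟨k₁, hk₁, a, ha⟩ := exists_subseq_tendsto_of_convexOn h hu hu0 hub
  obtain ⟨k₂, hk₂, b, hb⟩ := exists_subseq_tendsto_of_convexOn h (fun n => hv (k₁ n))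
    (fun n => hv0 (k₁ n)) (fun y hy => (hvb y hy).imp fun C hC n => hC (k₁ n))
  have hk : StrictMono (k₁ ∘ k₂) := hk₁.comp hk₂
  have ha' : ∀ y ∈ domJ μ ν, Tendsto (fun n => χ ((k₁ ∘ k₂) n) y) atTop (𝓝 (-a y)) := fun y hy => by
    have := ((ha y hy).comp hk₂.tendsto_atTop).neg
    simpa only [Function.comp_def, neg_neg] using this
  have hlim : ∀ y ∈ domJ μ ν, Tendsto (fun n => p ((k₁ ∘ k₂) n) y + q ((k₁ ∘ k₂) n) y) atTop
      (𝓝 (-a y + b y)) := fun y hy => by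
    simp only [← hsum]
    exact (ha' y hy).add (hb y hy)
  have haconc : ConcaveOn ℝ (domJ μ ν) fun y => -a y :=
    (convexOn_of_tendsto (fun n => hu (k₁ n)) ha).neg
  refine ⟨k₁ ∘ k₂, hk, fun y => -a y, b, haconc,
    convexOn_of_tendsto (fun n => hv (k₁ (k₂ n))) hb, hlim, ?_⟩
  -- Both terms are nonnegative and lower semicontinuous, so they can be treated separately.
  refine le_trans (add_le_add ?_ ?_) (le_liminf_add_ennreal _ _)
  · refine (hirr.concaveIntegral_le_liminf hμ hν (fun n => hχ ((k₁ ∘ k₂) n)) haconc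
      (fun n y hy => neg_nonneg.1 (hu0 _ y hy)) ha').trans_eq ?_
    simp only [hχc]
  · calc ∫⁻ y, ENNReal.ofReal (-a y + b y) ∂ν
        = ∫⁻ y, liminf (fun n => ENNReal.ofReal
            (p ((k₁ ∘ k₂) n) y + q ((k₁ ∘ k₂) n) y)) atTop ∂ν := by
          refine lintegral_congr_ae ?_
          filter_upwards [hirr.ae_mem_domJ hμ hν] with y hy
          exact ((ENNReal.continuous_ofReal.tendsto _).comp (hlim y hy)).liminf_eq.symm
      _ ≤ _ := lintegral_liminf_le' fun n => by
          have h1 := h.aestronglyMeasurable_concave (hp ((k₁ ∘ k₂) n)) (hirr.ae_mem_domJ hμ hν)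
          have h2 := h.aestronglyMeasurable_concave (hq ((k₁ ∘ k₂) n)).neg (hirr.ae_mem_domJ hμ hν)
          refine (AEMeasurable.ennreal_ofReal ((h1.sub h2).aemeasurable)).congr
            (ae_of_all _ fun y => ?_)
          simp

end Irreducible

lemma genIntegral_of_domI_eq_empty {μ ν : Measure ℝ} (hI : domI μ ν = ∅) (φ ψ : ℝ → EReal) :
    genIntegral μ ν φ ψ = 0 := by
  have hJ : domJ μ ν = ∅ := by simp [domJ, hI]
  unfold genIntegral
  split_ifs
  · simp [moderatedIntegral, concaveIntegral, hI, hJ]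
  · rfl

end AuxDual

/-! ### The proposition -/

open AuxDual in
theorem mainTheorem5 (μ ν : Measure ℝ) [IsFiniteMeasure μ] [IsFiniteMeasure ν]
    (hμ : Integrable (fun x : ℝ => x) μ) (hν : Integrable (fun x : ℝ => x) ν)
    (hirr : AuxDual.Irreducible μ ν)
    (f : ℝ → EReal) (fn : ℕ → ℝ → EReal)
    (hf : ∀ x ∈ AuxDual.domJ μ ν, 0 ≤ f x)
    (hfn : ∀ n, ∀ x ∈ AuxDual.domJ μ ν, 0 ≤ fn n x)
    (hlim : ∀ x ∈ AuxDual.domJ μ ν, Tendsto (fun n => fn n x) atTop (𝓝 (f x)))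
    (φn ψn : ℕ → ℝ → EReal)
    (hfeas : ∀ n, AuxDual.DualFeasible μ ν (fn n) (φn n) (ψn n))
    (hbdd : (⨆ n, AuxDual.genIntegral μ ν (φn n) (ψn n)) < ⊤) :
    ∃ φ ψ : ℝ → EReal, AuxDual.DualFeasible μ ν f φ ψ ∧
      AuxDual.genIntegral μ ν φ ψ ≤
        liminf (fun n => AuxDual.genIntegral μ ν (φn n) (ψn n)) atTop := by
  rcases (domI μ ν).eq_empty_or_nonempty with hI | hne
  · have hJ : domJ μ ν = ∅ := by simp [domJ, hI]
    refine ⟨φn 0, ψn 0, ⟨(hfeas 0).memLc, (hfeas 0).concave, (hfeas 0).convex, ?_⟩, ?_⟩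
    · simp [hJ]
    · simp [genIntegral_of_domI_eq_empty hI]
  have h := hirr.isIntervalPair hμ hν
  have hfin := fun n => hirr.dualFeasible_finite hμ hν hne (hfn n) (hfeas n)
  have hp : ∀ n, ConcaveOn ℝ (domJ μ ν) fun y => (φn n y).toReal := fun n =>
    (hfeas n).concave.concaveOn_toReal h.convex fun y hy => (hfin n y hy).1
  have hq : ∀ n, ConvexOn ℝ (domJ μ ν) fun y => (ψn n y).toReal := fun n =>
    (hfeas n).convex.convexOn_toReal h.convex fun y hy => (hfin n y hy).2
  have hcoe : ∀ n, ∀ y ∈ domJ μ ν,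
      φn n y + ψn n y = (((φn n y).toReal + (ψn n y).toReal : ℝ) : EReal) := fun n y hy => by
    rw [EReal.coe_add, EReal.coe_toReal (hfin n y hy).1.1 (hfin n y hy).1.2,
      EReal.coe_toReal (hfin n y hy).2.1 (hfin n y hy).2.2]
  have hs : ∀ n, ∀ y ∈ domJ μ ν, 0 ≤ (φn n y).toReal + (ψn n y).toReal := fun n y hy => by
    have := (hfn n y hy).trans ((hfeas n).superhedge y hy)
    rwa [hcoe n y hy, EReal.coe_nonneg] at this
  have hgen := fun n => hirr.genIntegral_eq hμ hν (hp n) (hs n)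
    ((hfeas n).memLc.moderator.imp fun _ hχ => hχ.1) ((le_iSup _ n).trans_lt hbdd)
  -- The value computed with `φₙ` as its own moderator, as a sum in `ℝ≥0∞`.
  let W : ℕ → ℝ≥0∞ := fun n => concaveIntegral μ ν (fun y => (φn n y).toReal)
    + ∫⁻ y, ENNReal.ofReal ((φn n y).toReal + (ψn n y).toReal) ∂ν
  have hW : ∀ n, (W n : EReal) = genIntegral μ ν (φn n) (ψn n) := fun n => by
    obtain ⟨h1, h2, h3⟩ := hgen n
    have hnn : 0 ≤ᵐ[ν] fun y => (φn n y).toReal + (ψn n y).toReal := by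
      filter_upwards [hirr.ae_mem_domJ hμ hν] with y hy using hs n y hy
    rw [h3]
    simp only [W]
    rw [EReal.coe_ennreal_add, EReal.coe_add, EReal.coe_ennreal_toReal h1.ne,
      ← ofReal_integral_eq_lintegral_ofReal h2 hnn, EReal.coe_ennreal_ofReal,
      max_eq_left (integral_nonneg_of_ae hnn)]
  -- The values converge to the lower limit along `k₁`, so the further extraction for compactness
  -- does not change it.
  obtain ⟨k₁, hk₁, hk₁'⟩ := exists_seq_tendsto_liminf (f := atTop)
    (u := fun n => genIntegral μ ν (φn n) (ψn n))
  have hB : (⨆ n, W n) ≠ ⊤ := by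
    intro htop
    have : ∀ n, W n ≤ (⨆ n, genIntegral μ ν (φn n) (ψn n)).toENNReal := fun n => by
      rw [← EReal.toENNReal_coe (x := W n), hW]
      exact EReal.toENNReal_le_toENNReal (le_iSup (fun n => genIntegral μ ν (φn n) (ψn n)) n)
    have h2 := iSup_le this
    rw [htop, top_le_iff, EReal.toENNReal_eq_top_iff] at h2
    exact hbdd.ne h2
  obtain ⟨k₂, hk₂, a, b, ha, hb, hab, hle⟩ := hirr.exists_subseq_tendsto hμ hν hne
    (fun n => hp (k₁ n)) (fun n => hq (k₁ n)) (fun n => hs (k₁ n)) hB (fun n => le_iSup W (k₁ n))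
  have hk₂' : Tendsto (k₁ ∘ k₂) atTop atTop := hk₁'.comp hk₂.tendsto_atTop
  have hlimW : ((liminf (fun n => W (k₁ (k₂ n))) atTop : ℝ≥0∞) : EReal) =
      liminf (fun n => genIntegral μ ν (φn n) (ψn n)) atTop := by
    obtain ⟨j, hj, hj'⟩ := exists_seq_tendsto_liminf (f := atTop) (u := fun n => W (k₁ (k₂ n)))
    have t1 := (continuous_coe_ennreal_ereal.tendsto _).comp hj
    have t2 := hk₁.comp (hk₂.tendsto_atTop.comp hj')
    refine tendsto_nhds_unique t1 (t2.congr fun n => ?_)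
    exact (hW _).symm
  have hab0 : ∀ y ∈ domJ μ ν, 0 ≤ a y + b y := fun y hy =>
    ge_of_tendsto' (hab y hy) fun n => hs _ y hy
  have hfinite : concaveIntegral μ ν a + ∫⁻ y, ENNReal.ofReal (a y + b y) ∂ν < ⊤ := by
    refine hle.trans_lt (lt_of_le_of_lt ?_ (lt_top_iff_ne_top.2 hB))
    exact liminf_le_of_frequently_le' (Eventually.frequently
      (Eventually.of_forall fun n => le_iSup W (k₁ (k₂ n))))
  have hca := (ENNReal.add_lt_top.1 hfinite).1
  have hbm := h.aestronglyMeasurable_concave hb.neg (hirr.ae_mem_domJ hμ hν)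
  have ham := h.aestronglyMeasurable_concave ha (hirr.ae_mem_domJ hμ hν)
  have hnn : 0 ≤ᵐ[ν] fun y => a y + b y := by
    filter_upwards [hirr.ae_mem_domJ hμ hν] with y hy using hab0 y hy
  have hint : Integrable (fun y => a y + b y) ν := by
    refine ⟨(ham.sub hbm).congr (ae_of_all _ fun y => by simp), ?_⟩
    rw [hasFiniteIntegral_iff_ofReal hnn]
    exact (ENNReal.add_lt_top.1 hfinite).2
  obtain ⟨hmod, hval⟩ := hirr.genIntegral_eq_of_concaveIntegral_lt_top hμ hν ha hab0 hca hint
  have hmeas : ∀ u : ℝ → ℝ, ConcaveOn ℝ (domJ μ ν) u →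
      Measurable ((domJ μ ν).domRestrict u) := fun u hu => by
    convert (h.measurable_concave hu).comp measurable_subtype_coe using 1
    ext y
    exact (indicator_of_mem y.2 u).symm
  refine ⟨fun y => (a y : EReal), fun y => (b y : EReal),
    ⟨⟨(hmeas a ha).coe_real_ereal, ?_, a, hmod, hca⟩, econcaveOn_coe ha, econvexOn_coe hb, ?_⟩, ?_⟩
  · have := ((hmeas _ hb.neg).neg).coe_real_ereal
    convert this using 1
    ext y
    simp [Set.domRestrict]
  -- Pointwise limit of `fₙ ≤ φₙ + ψₙ`; the affine corrections cancel in the sum.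
  · intro y hy
    have t1 := (hlim y hy).comp hk₂'
    have t2 := (continuous_coe_real_ereal.tendsto _).comp (hab y hy)
    rw [← EReal.coe_add]
    refine le_of_tendsto_of_tendsto' t1 t2 fun n => ?_
    simp only [Function.comp]
    rw [← hcoe _ y hy]
    exact (hfeas _).superhedge y hy
  · rw [hval, ← hlimW, EReal.coe_add, EReal.coe_ennreal_toReal hca.ne]
    refine le_trans (le_of_eq ?_) (EReal.coe_ennreal_le_coe_ennreal_iff.2 hle)
    rw [EReal.coe_ennreal_add, ← ofReal_integral_eq_lintegral_ofReal hint hnn,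
      EReal.coe_ennreal_ofReal, max_eq_left (integral_nonneg_of_ae hnn)]
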